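/- Let $\mathbb k$ be a field of characteristic zero and $p\ge 1$. Let $q_1,\dots,q_p\in\mathbb k\setminus\{0,1\}$ and let $h_1,\dots,h_p\in\mathbb k[t]$ be non-constant polynomials such that $h_j(q_it)=h_j(t)$ whenever $i\ne j$. Let $A$ be the corresponding quantum generalized Weyl algebra of rank $p$, i.e. the $\mathbb k$-algebra generated by $t,u_1,\dots,u_p,v_1,\dots,v_p$ subject to $$u_it=q_itu_i,\quad v_it=q_i^{-1}tv_i,\quad u_iv_i=h_i(q_it),\quad v_iu_i=h_i(t)\quad\text{for all } i,$$ $$u_iu_j=u_ju_i,\quad v_iv_j=v_jv_i,\quad u_iv_j=v_ju_i\quad\text{for all } i\neq j,$$ $\mathbb Z^p$-graded by $\deg t=0$, $\deg u_i=e_i$, $\deg v_i=-e_i$. Let $A_i$ be the (rank one) quantum generalized Weyl subalgebra generated by $t,u_i,v_i$, with its induced $\mathbb Z$-grading ($\deg t=0$, $\deg u_i=1$, $\deg v_i=-1$). Assume $q_i\neq-1$ for all $i$. Let $m,n$ be positive integers with $m>1$ and $m\mid n$, let $\lambda\in\mathbb k$ be a primitive $m$-th root of unity, and let $$T=T_n(\lambda,m)=\mathbb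 k\langle x,g\mid g^n-1,\ x^m,\ gx-\lambda xg\rangle$$ be the generalized Taft algebra, a Hopf algebra with $\Delta(g)=g\otimes g$, $\Delta(x)=g\otimes x+x\otimes 1$, $\epsilon(g)=1$, $\epsilon(x)=0$. A $T$-module algebra $M$ is inner-faithful if $IM\ne0$ for every nonzero Hopf ideal $I$ of $T$; a $T$-module algebra structure on a $\mathbb Z$-graded algebra $B$ is weakly $\mathbb Z$-graded if $T(B_0)\subseteq B_0$ and $T(B_{-N}\oplus B_N)\subseteq B_{-N}\oplus B_N$ for all $N\in\mathbb N$. Suppose each $A_i$ is given an inner-faithful weakly $\mathbb Z$-graded $T$-module algebra structure, and that these structures agree on the common subalgebra $\mathbb k[t]$ of the $A_i$. Then there is an inner-faithful $T$-module algebra structure on $A$ that is $\mathbb Z^p$-graded (each homogeneous component $A_d$, $d\in\mathbb Z^p$, is a $T$-submodule) and that restricts to the given action on each subalgebra $A_i$. -/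

import Mathlib

open scoped TensorProduct Polynomial

noncomputable section

/-! ### Generalized Taft algebras -/

/-- The data `(n, m, λ)` defining a generalized Taft algebra over `k`: positive integers `m, n`
with `m > 1` and `m ∣ n`, and a primitive `m`-th root of unity `λ` (called `lam`) in `k`. -/
structure TaftDatum (k : Type*) [Field k] where
  n : ℕ
  m : ℕ
  lam : k
  n_pos : 0 < n
  one_lt_m : 1 < m
  m_dvd_n : m ∣ n
  prim : IsPrimitiveRoot lam m

/-- The two algebra generators of a generalized Taft algebra. -/
inductive TaftGen : Type
  | g : TaftGen
  | x : TaftGen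

/-- The defining relations `g ^ n = 1`, `x ^ m = 0`, `g x = λ x g`. -/
inductive TaftRel {k : Type*} [Field k] (D : TaftDatum k) :
    FreeAlgebra k TaftGen → FreeAlgebra k TaftGen → Prop
  | g_pow : TaftRel D (FreeAlgebra.ι k TaftGen.g ^ D.n) 1
  | x_pow : TaftRel D (FreeAlgebra.ι k TaftGen.x ^ D.m) 0
  | g_x : TaftRel D (FreeAlgebra.ι k TaftGen.g * FreeAlgebra.ι k TaftGen.x)
      (D.lam • (FreeAlgebra.ι k TaftGen.x * FreeAlgebra.ι k TaftGen.g))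

/-- The generalized Taft algebra `T_n(λ, m) = k⟨x, g | g ^ n - 1, x ^ m, g x - λ x g⟩`. -/
def TaftAlgebra {k : Type*} [Field k] (D : TaftDatum k) : Type _ := RingQuot (TaftRel D)

namespace TaftAlgebra

variable {k : Type*} [Field k] (D : TaftDatum k)

instance : Ring (TaftAlgebra D) := inferInstanceAs (Ring (RingQuot (TaftRel D)))

instance : Algebra k (TaftAlgebra D) := inferInstanceAs (Algebra k (RingQuot (TaftRel D)))

/-- The quotient map from the free algebra. -/
def mk : FreeAlgebra k TaftGen →ₐ[k] TaftAlgebra D := RingQuot.mkAlgHom k (TaftRel D)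

/-- The generator `g`. -/
def g : TaftAlgebra D := mk D (FreeAlgebra.ι k TaftGen.g)

/-- The generator `x`. -/
def x : TaftAlgebra D := mk D (FreeAlgebra.ι k TaftGen.x)

lemma mk_surjective : Function.Surjective (mk D) := RingQuot.mkAlgHom_surjective k (TaftRel D)

lemma g_pow : g D ^ D.n = 1 := by
  have := RingQuot.mkAlgHom_rel k (TaftRel.g_pow (D := D))
  rw [map_pow, map_one] at this
  exact this

lemma x_pow : x D ^ D.m = 0 := by
  have := RingQuot.mkAlgHom_rel k (TaftRel.x_pow (D := D))
  rw [map_pow, map_zero] at this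
  exact this

lemma g_mul_x : g D * x D = D.lam • (x D * g D) := by
  have := RingQuot.mkAlgHom_rel k (TaftRel.g_x (D := D))
  rw [map_smul, map_mul, map_mul] at this
  exact this

variable {D} in
/-- The universal property of the presentation. -/
def lift {B : Type*} [Ring B] [Algebra k B] (g' x' : B) (hg : g' ^ D.n = 1) (hx : x' ^ D.m = 0)
    (hgx : g' * x' = D.lam • (x' * g')) : TaftAlgebra D →ₐ[k] B :=
  RingQuot.liftAlgHom k ⟨FreeAlgebra.lift k (fun a => TaftGen.casesOn a g' x'), by
    intro a b r
    cases r <;> simp [hg, hx, hgx]⟩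

section lift

variable {D} {B : Type*} [Ring B] [Algebra k B] (g' x' : B) (hg : g' ^ D.n = 1)
  (hx : x' ^ D.m = 0) (hgx : g' * x' = D.lam • (x' * g'))

@[simp] lemma lift_g : lift g' x' hg hx hgx (g D) = g' := by
  simp only [lift, g, mk]
  erw [RingQuot.liftAlgHom_mkAlgHom_apply]
  simp

@[simp] lemma lift_x : lift g' x' hg hx hgx (x D) = x' := by
  simp only [lift, x, mk]
  erw [RingQuot.liftAlgHom_mkAlgHom_apply]
  simp

end lift

variable {D} in
lemma algHom_ext {B : Type*} [Semiring B] [Algebra k B] {f f' : TaftAlgebra D →ₐ[k] B}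
    (hg : f (g D) = f' (g D)) (hx : f (x D) = f' (x D)) : f = f' := by
  refine RingQuot.ringQuot_ext' k f f' (FreeAlgebra.hom_ext (funext fun a => ?_))
  cases a
  · exact hg
  · exact hx

variable {D} in
lemma induction {P : TaftAlgebra D → Prop} (hc : ∀ c : k, P (algebraMap k _ c))
    (hg : P (g D)) (hx : P (x D)) (hmul : ∀ a b, P a → P b → P (a * b))
    (hadd : ∀ a b, P a → P b → P (a + b)) (a : TaftAlgebra D) : P a := by
  obtain ⟨a, rfl⟩ := mk_surjective D a
  induction a using FreeAlgebra.induction with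
  | grade0 r => simpa using hc r
  | grade1 y => cases y <;> assumption
  | mul a b ha hb => simpa using hmul _ _ ha hb
  | add a b ha hb => simpa using hadd _ _ ha hb

/-! The quantum binomial theorem at a primitive root of unity. -/

/-- Gaussian binomial coefficients, by the Pascal recursion. -/
def gauss (l : k) : ℕ → ℕ → k
  | _, 0 => 1
  | 0, _ + 1 => 0
  | n + 1, j + 1 => gauss l n j + l ^ (j + 1) * gauss l n (j + 1)

lemma gauss_eq_zero (l : k) : ∀ n j, n < j → gauss l n j = 0
  | 0, j + 1, _ => by simp [gauss]
  | n + 1, j + 1, h => by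
    simp [gauss, gauss_eq_zero l n j (by omega), gauss_eq_zero l n (j + 1) (by omega)]

lemma gauss_self (l : k) : ∀ n, gauss l n n = 1
  | 0 => by simp [gauss]
  | n + 1 => by simp [gauss, gauss_self l n, gauss_eq_zero l n (n + 1) (by omega)]

lemma gauss_aux (l : k) (n : ℕ) : ∀ j,
    (l ^ (j + 1) - 1) * l ^ j * gauss l n (j + 1) = (l ^ n - l ^ j) * gauss l n j := by
  induction n with
  | zero =>
    intro j
    cases j <;> simp [gauss]
  | succ n ih =>
    intro j
    cases j with
    | zero =>
      have h0 := ih 0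
      simp only [gauss] at h0 ⊢
      linear_combination l * h0
    | succ i =>
      have h0 := ih i
      have h1 := ih (i + 1)
      simp only [gauss] at h0 h1 ⊢
      linear_combination l ^ (i + 2) * h1 + l * h0

lemma gauss_prim {l : k} {m : ℕ} (hl : IsPrimitiveRoot l m) {j : ℕ} (hj0 : 0 < j) (hj : j < m) :
    gauss l m j = 0 := by
  induction j with
  | zero => omega
  | succ j ih =>
    have h := gauss_aux l m j
    have hl0 : l ≠ 0 := hl.ne_zero (by omega)
    have hne : l ^ (j + 1) - 1 ≠ 0 := sub_ne_zero.2 (hl.pow_ne_one_of_pos_of_lt (by omega) hj)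
    have hr : (l ^ m - l ^ j) * gauss l m j = 0 := by
      rcases Nat.eq_zero_or_pos j with rfl | hpos
      · simp [hl.pow_eq_one]
      · rw [ih hpos (by omega), mul_zero]
    rw [hr] at h
    simpa [hl0, hne] using h

lemma mul_pow_comm {B : Type*} [Ring B] [Algebra k B] {a b : B} {l : k}
    (hab : a * b = l • (b * a)) (j : ℕ) : a ^ j * b = l ^ j • (b * a ^ j) := by
  induction j with
  | zero => simp
  | succ j ih =>
    rw [pow_succ, mul_assoc, hab, mul_smul_comm, ← mul_assoc, ih, smul_mul_assoc, smul_smul,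
      pow_succ l, mul_assoc, mul_comm (l ^ j) l]

lemma add_pow_gauss {B : Type*} [Ring B] [Algebra k B] {a b : B} {l : k}
    (hab : a * b = l • (b * a)) (n : ℕ) :
    (b + a) ^ n = ∑ j ∈ Finset.range (n + 1), gauss l n j • (b ^ (n - j) * a ^ j) := by
  induction n with
  | zero => simp [gauss]
  | succ n ih =>
    have key : ∀ j ∈ Finset.range (n + 1),
        gauss l n j • (b ^ (n - j) * a ^ j) * (b + a) =
          (l ^ j * gauss l n j) • (b ^ (n + 1 - j) * a ^ j) +
          gauss l n j • (b ^ (n + 1 - (j + 1)) * a ^ (j + 1)) := by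
      intro j hj
      have hj' : j ≤ n := by simpa [Nat.lt_succ_iff] using hj
      rw [mul_add, smul_mul_assoc, smul_mul_assoc, mul_assoc, mul_pow_comm hab, mul_smul_comm,
        ← mul_assoc, ← pow_succ, smul_smul, mul_assoc, ← pow_succ, Nat.succ_sub hj',
        mul_comm (gauss l n j), Nat.succ_sub_succ]
    rw [pow_succ, ih, Finset.sum_mul, Finset.sum_congr rfl key, Finset.sum_add_distrib,
      Finset.sum_range_succ' _ (n + 1)]
    simp only [gauss, add_smul, Finset.sum_add_distrib]
    rw [Finset.sum_range_succ' (fun j => (l ^ j * gauss l n j) • (b ^ (n + 1 - j) * a ^ j)) n,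
      Finset.sum_range_succ
        (fun j => (l ^ (j + 1) * gauss l n (j + 1)) • (b ^ (n + 1 - (j + 1)) * a ^ (j + 1))) n,
      gauss_eq_zero l n (n + 1) (by omega)]
    simp [gauss]
    abel

lemma add_pow_prim {B : Type*} [Ring B] [Algebra k B] {a b : B} {l : k} {m : ℕ} (hm : 0 < m)
    (hl : IsPrimitiveRoot l m) (hab : a * b = l • (b * a)) : (b + a) ^ m = b ^ m + a ^ m := by
  obtain ⟨m, rfl⟩ : ∃ r, m = r + 1 := ⟨m - 1, by omega⟩
  rw [add_pow_gauss hab, Finset.sum_range_succ, Finset.sum_range_succ', Finset.sum_eq_zero]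
  · simp [gauss_self, show gauss l (m + 1) 0 = 1 from rfl]
  · intro j hj
    rw [gauss_prim hl (by omega) (by simpa using hj), zero_smul]

/-! The Hopf algebra structure: `g` is grouplike, `x` is `(g, 1)`-skew-primitive. -/

/-- The comultiplication: `Δ g = g ⊗ g`, `Δ x = g ⊗ x + x ⊗ 1`. -/
def comulHom : TaftAlgebra D →ₐ[k] TaftAlgebra D ⊗[k] TaftAlgebra D :=
  lift (g D ⊗ₜ g D) (g D ⊗ₜ x D + x D ⊗ₜ 1)
    (by simp [g_pow, Algebra.TensorProduct.one_def])
    (by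
      rw [add_comm, add_pow_prim (zero_lt_one.trans D.one_lt_m) D.prim]
      · simp [x_pow]
      · simp [g_mul_x, TensorProduct.smul_tmul'])
    (by simp [mul_add, add_mul, g_mul_x, TensorProduct.smul_tmul', smul_add])

/-- The counit: `ε g = 1`, `ε x = 0`. -/
def counitHom : TaftAlgebra D →ₐ[k] k :=
  lift 1 0 (by simp) (by simp [(zero_lt_one.trans D.one_lt_m).ne']) (by simp)

@[simp] lemma comulHom_g : comulHom D (g D) = g D ⊗ₜ g D := by simp [comulHom]

@[simp] lemma comulHom_x : comulHom D (x D) = g D ⊗ₜ x D + x D ⊗ₜ 1 := by simp [comulHom]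

@[simp] lemma counitHom_g : counitHom D (g D) = 1 := by simp [counitHom]

@[simp] lemma counitHom_x : counitHom D (x D) = 0 := by simp [counitHom]

instance : Bialgebra k (TaftAlgebra D) :=
  Bialgebra.ofAlgHom (comulHom D) (counitHom D)
    (algHom_ext (by simp) (by
      simp [TensorProduct.add_tmul, TensorProduct.tmul_add, Algebra.TensorProduct.one_def,
        add_assoc]))
    (algHom_ext (by simp) (by simp))
    (algHom_ext (by simp) (by simp))

/-- The inverse `g ^ (n - 1)` of `g`. -/
def gInv : TaftAlgebra D := g D ^ (D.n - 1)

lemma gInv_mul_g : gInv D * g D = 1 := by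
  rw [gInv, ← pow_succ, Nat.sub_add_cancel D.n_pos, g_pow]

lemma g_mul_gInv : g D * gInv D = 1 := by
  rw [gInv, ← pow_succ', Nat.sub_add_cancel D.n_pos, g_pow]

lemma x_mul_gInv : x D * gInv D = D.lam • (gInv D * x D) := by
  calc x D * gInv D = gInv D * (g D * x D) * gInv D := by
        rw [← mul_assoc, gInv_mul_g, one_mul]
    _ = D.lam • (gInv D * x D) := by
        rw [g_mul_x, mul_smul_comm, smul_mul_assoc, mul_assoc, mul_assoc, g_mul_gInv, mul_one]

lemma gInv_mul_x_pow (j : ℕ) :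
    ∃ c : k, (gInv D * x D) ^ j = c • (gInv D ^ j * x D ^ j) := by
  induction j with
  | zero => exact ⟨1, by simp⟩
  | succ j ih =>
    obtain ⟨c, hc⟩ := ih
    refine ⟨c * D.lam ^ j, ?_⟩
    rw [pow_succ, hc, smul_mul_assoc, mul_assoc, ← mul_assoc (x D ^ j),
      mul_pow_comm (x_mul_gInv D) j, smul_mul_assoc, mul_smul_comm, smul_smul, pow_succ (gInv D),
      pow_succ (x D), mul_assoc, mul_assoc]

/-- The antipode as a homomorphism to the opposite algebra: `S g = g⁻¹`, `S x = - g⁻¹ x`. -/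
def antipodeHom : TaftAlgebra D →ₐ[k] (TaftAlgebra D)ᵐᵒᵖ :=
  lift (MulOpposite.op (gInv D)) (MulOpposite.op (-(gInv D * x D)))
    (by
      rw [← MulOpposite.op_pow, gInv, ← pow_mul, mul_comm, pow_mul, g_pow, one_pow,
        MulOpposite.op_one])
    (by
      obtain ⟨c, hc⟩ := gInv_mul_x_pow D D.m
      rw [← MulOpposite.op_pow, neg_pow, hc, x_pow]
      simp)
    (by
      rw [← MulOpposite.op_mul, ← MulOpposite.op_mul, ← MulOpposite.op_smul, neg_mul, mul_neg,
        mul_assoc, x_mul_gInv, mul_smul_comm, smul_neg])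

/-- The antipode as a linear map. -/
def antipodeLin : TaftAlgebra D →ₗ[k] TaftAlgebra D :=
  (MulOpposite.opLinearEquiv k).symm.toLinearMap ∘ₗ (antipodeHom D).toLinearMap

lemma antipodeLin_g : antipodeLin D (g D) = gInv D := by simp [antipodeLin, antipodeHom]

lemma antipodeLin_x : antipodeLin D (x D) = -(gInv D * x D) := by simp [antipodeLin, antipodeHom]

lemma antipodeLin_algebraMap (c : k) :
    antipodeLin D (algebraMap k _ c) = algebraMap k _ c := by simp [antipodeLin]

lemma antipodeLin_one : antipodeLin D 1 = 1 := by simp [antipodeLin]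

lemma antipodeLin_mul (a b : TaftAlgebra D) :
    antipodeLin D (a * b) = antipodeLin D b * antipodeLin D a := by simp [antipodeLin]

/-- `a ⊗ b ↦ S(a) b`. -/
def convL : TaftAlgebra D ⊗[k] TaftAlgebra D →ₗ[k] TaftAlgebra D :=
  LinearMap.mul' k (TaftAlgebra D) ∘ₗ (antipodeLin D).rTensor (TaftAlgebra D)

/-- `a ⊗ b ↦ a S(b)`. -/
def convR : TaftAlgebra D ⊗[k] TaftAlgebra D →ₗ[k] TaftAlgebra D :=
  LinearMap.mul' k (TaftAlgebra D) ∘ₗ (antipodeLin D).lTensor (TaftAlgebra D)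

lemma convL_tmul (a b : TaftAlgebra D) : convL D (a ⊗ₜ b) = antipodeLin D a * b := by
  simp [convL]

lemma convR_tmul (a b : TaftAlgebra D) : convR D (a ⊗ₜ b) = a * antipodeLin D b := by
  simp [convR]

lemma convL_mul (z : TaftAlgebra D ⊗[k] TaftAlgebra D) (c : k)
    (hz : convL D z = algebraMap k _ c) (w : TaftAlgebra D ⊗[k] TaftAlgebra D) :
    convL D (z * w) = c • convL D w := by
  have key : ∀ (z : TaftAlgebra D ⊗[k] TaftAlgebra D) (a b : TaftAlgebra D),
      convL D (z * a ⊗ₜ b) = antipodeLin D a * convL D z * b := by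
    intro z a b
    induction z with
    | zero => simp
    | tmul p r =>
      rw [Algebra.TensorProduct.tmul_mul_tmul, convL_tmul, convL_tmul, antipodeLin_mul]
      simp only [mul_assoc]
    | add y z hy hz => rw [add_mul, map_add, hy, hz, map_add, mul_add, add_mul]
  induction w with
  | zero => simp
  | tmul a b =>
    rw [key, hz, ← Algebra.commutes, mul_assoc, ← Algebra.smul_def, convL_tmul]
  | add y z hy hz => rw [mul_add, map_add, hy, hz, map_add, smul_add]

lemma convR_mul (z : TaftAlgebra D ⊗[k] TaftAlgebra D) (c : k)
    (hz : convR D z = algebraMap k _ c) (w : TaftAlgebra D ⊗[k] TaftAlgebra D) :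
    convR D (w * z) = c • convR D w := by
  have key : ∀ (z : TaftAlgebra D ⊗[k] TaftAlgebra D) (a b : TaftAlgebra D),
      convR D (a ⊗ₜ b * z) = a * convR D z * antipodeLin D b := by
    intro z a b
    induction z with
    | zero => simp
    | tmul p r =>
      rw [Algebra.TensorProduct.tmul_mul_tmul, convR_tmul, convR_tmul, antipodeLin_mul]
      simp only [mul_assoc]
    | add y z hy hz => rw [mul_add, map_add, hy, hz, map_add, mul_add, add_mul]
  induction w with
  | zero => simp
  | tmul a b =>
    rw [key, hz, ← Algebra.commutes, mul_assoc, ← Algebra.smul_def, convR_tmul]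
  | add y z hy hz => rw [add_mul, map_add, hy, hz, map_add, smul_add]

lemma convL_comul (a : TaftAlgebra D) :
    convL D (comulHom D a) = algebraMap k _ (counitHom D a) := by
  induction a using TaftAlgebra.induction with
  | hc c =>
    simp [AlgHom.commutes, Algebra.TensorProduct.algebraMap_apply, convL_tmul,
      antipodeLin_algebraMap]
  | hg => simp [convL_tmul, antipodeLin_g, gInv_mul_g]
  | hx => simp [convL_tmul, antipodeLin_g, antipodeLin_x]
  | hmul a b ha hb =>
    rw [map_mul, convL_mul D _ _ ha, hb, map_mul, map_mul, Algebra.smul_def]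
  | hadd a b ha hb => simp [ha, hb]

lemma convR_comul (a : TaftAlgebra D) :
    convR D (comulHom D a) = algebraMap k _ (counitHom D a) := by
  induction a using TaftAlgebra.induction with
  | hc c =>
    simp [AlgHom.commutes, Algebra.TensorProduct.algebraMap_apply, convR_tmul,
      antipodeLin_one]
  | hg => simp [convR_tmul, antipodeLin_g, g_mul_gInv]
  | hx => simp [convR_tmul, antipodeLin_x, antipodeLin_one, ← mul_assoc, g_mul_gInv]
  | hmul a b ha hb =>
    rw [map_mul, convR_mul D _ _ hb, ha, map_mul, map_mul, Algebra.smul_def, Algebra.commutes]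
  | hadd a b ha hb => simp [ha, hb]

/-- The Hopf algebra structure of `T_n(λ, m)`. -/
instance : HopfAlgebra k (TaftAlgebra D) where
  antipode := antipodeLin D
  mul_antipode_rTensor_comul := LinearMap.ext fun a => convL_comul D a
  mul_antipode_lTensor_comul := LinearMap.ext fun a => convR_comul D a

end TaftAlgebra

/-! ### Module algebras over a Hopf algebra -/

/-- A left `H`-module algebra structure on the `k`-algebra `A`: a left `H`-module structure
(an algebra homomorphism `H → End_k A`) with `h(1) = ε(h) 1` and `h(a b) = ∑ h₁(a) h₂(b)`. -/
structure ModuleAlgebraStr (k H A : Type*) [Field k] [Ring H] [HopfAlgebra k H] [Ring A]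
    [Algebra k A] where
  act : H →ₐ[k] Module.End k A
  act_one : ∀ h : H, act h 1 = Coalgebra.counit (R := k) h • (1 : A)
  act_mul : ∀ (h : H) (a b : A), act h (a * b) =
    LinearMap.mul' k A (TensorProduct.map (act.toLinearMap.flip a) (act.toLinearMap.flip b)
      (Coalgebra.comul (R := k) h))

namespace ModuleAlgebraStr

variable {k H A : Type*} [Field k] [Ring H] [HopfAlgebra k H] [Ring A] [Algebra k A]

/-- The action is inner-faithful: `I A ≠ 0` for every nonzero Hopf ideal `I` of `H`. -/
def InnerFaithful (ρ : ModuleAlgebraStr k H A) : Prop :=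
  ∀ I : Ideal H, I.IsTwoSided → I.IsHopfIdeal k → I ≠ ⊥ → ∃ h ∈ I, ∃ a : A, ρ.act h a ≠ 0

/-- The subspace `V` of `A` is stable under the action of `H`. -/
def Stable (ρ : ModuleAlgebraStr k H A) (V : Submodule k A) : Prop :=
  ∀ h : H, ∀ a ∈ V, ρ.act h a ∈ V

/-- The action respects a grading `(A_d)_d` of `A`: each component is stable. -/
def Graded {ι : Type*} (ρ : ModuleAlgebraStr k H A) (comp : ι → Submodule k A) : Prop :=
  ∀ d, ρ.Stable (comp d)

/-- The action respects a `ℤ`-grading weakly: `A_0` and all `A_{-N} ⊕ A_N` are stable. -/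
def WeaklyGraded (ρ : ModuleAlgebraStr k H A) (comp : ℤ → Submodule k A) : Prop :=
  ∀ N : ℕ, ρ.Stable (comp (-(N : ℤ)) ⊔ comp (N : ℤ))

end ModuleAlgebraStr

/-! ### Quantum generalized Weyl algebras of rank `p` -/

/-- The generators `t`, `u_i`, `v_i`. -/
inductive QGWAGen (p : ℕ) : Type
  | t : QGWAGen p
  | u : Fin p → QGWAGen p
  | v : Fin p → QGWAGen p

/-- The degrees in `ℤ^p`: `deg t = 0`, `deg u_i = e_i`, `deg v_i = - e_i`. -/
def QGWAGen.deg {p : ℕ} : QGWAGen p → (Fin p → ℤ)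
  | .t => 0
  | .u i => Pi.single i 1
  | .v i => -Pi.single i 1

section QGWA

variable {k : Type*} [Field k] {p : ℕ}

/-- The generators in the free algebra. -/
local notation "𝐭" => FreeAlgebra.ι k QGWAGen.t
local notation "𝐮" i:max => FreeAlgebra.ι k (QGWAGen.u i)
local notation "𝐯" i:max => FreeAlgebra.ι k (QGWAGen.v i)

/-- The defining relations of the quantum GWA of rank `p`. -/
inductive QGWARel (q : Fin p → k) (h : Fin p → k[X]) :
    FreeAlgebra k (QGWAGen p) → FreeAlgebra k (QGWAGen p) → Prop
  | u_t (i : Fin p) : QGWARel q h (𝐮 i * 𝐭) (q i • (𝐭 * 𝐮 i))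
  | v_t (i : Fin p) : QGWARel q h (𝐯 i * 𝐭) ((q i)⁻¹ • (𝐭 * 𝐯 i))
  | u_v (i : Fin p) : QGWARel q h (𝐮 i * 𝐯 i) (Polynomial.aeval (q i • 𝐭) (h i))
  | v_u (i : Fin p) : QGWARel q h (𝐯 i * 𝐮 i) (Polynomial.aeval 𝐭 (h i))
  | comm_uu (i j : Fin p) : i ≠ j → QGWARel q h (𝐮 i * 𝐮 j) (𝐮 j * 𝐮 i)
  | comm_vv (i j : Fin p) : i ≠ j → QGWARel q h (𝐯 i * 𝐯 j) (𝐯 j * 𝐯 i)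
  | comm_uv (i j : Fin p) : i ≠ j → QGWARel q h (𝐮 i * 𝐯 j) (𝐯 j * 𝐮 i)

/-- The rank `p` quantum GWA `k[t](u, v, σ, h)`, where `σ_i(t) = q_i t`. -/
def QGWA (q : Fin p → k) (h : Fin p → k[X]) : Type _ := RingQuot (QGWARel q h)

namespace QGWA

variable (q : Fin p → k) (h : Fin p → k[X])

instance : Ring (QGWA q h) := inferInstanceAs (Ring (RingQuot (QGWARel q h)))

instance : Algebra k (QGWA q h) := inferInstanceAs (Algebra k (RingQuot (QGWARel q h)))

/-- The generators of the rank `p` quantum GWA. -/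
def gen (a : QGWAGen p) : QGWA q h := RingQuot.mkAlgHom k (QGWARel q h) (FreeAlgebra.ι k a)

/-- The component of degree `d ∈ ℤ^p`: the span of all words of degree `d` in the generators. -/
def component (d : Fin p → ℤ) : Submodule k (QGWA q h) :=
  Submodule.span k
    {a | ∃ w : List (QGWAGen p), (w.map QGWAGen.deg).sum = d ∧ a = (w.map (gen q h)).prod}

/-- The subalgebra `A_i` generated by `t`, `u_i`, `v_i`. -/
def rankOne (i : Fin p) : Subalgebra k (QGWA q h) :=
  Algebra.adjoin k {gen q h .t, gen q h (.u i), gen q h (.v i)}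

/-- The element `t` of `A_i`. -/
def rankOneT (i : Fin p) : rankOne q h i :=
  ⟨gen q h .t, Algebra.subset_adjoin (by simp)⟩

/-- The `ℤ`-grading of `A_i` (with `deg t = 0`, `deg u_i = 1`, `deg v_i = -1`), inherited from
the `ℤ^p`-grading: its component of degree `N` is `A_i ∩ A_{N e_i}`. -/
def rankOneComponent (i : Fin p) (N : ℤ) : Submodule k (rankOne q h i) :=
  (component q h (Pi.single i N)).comap (rankOne q h i).val.toLinearMap

end QGWA

end QGWA

end

/-! An action of a generalized Taft algebra on an algebra `B` amounts to a pair `(G, X)`: an algebra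
endomorphism `G` and a linear map `X` with `X (a b) = G a * X b + X a * b`, subject to the Taft
relations. Leaving those relations aside, such a pair is the same as a homomorphism `a ↦ (G a, X a;
0, a)` from `B` to upper triangular matrices over `B`. Since `A` is given by a presentation, a pair
on `A` is built by choosing matrices for the generators and checking the relations of `A`.

In rank one, `q_i ≠ ±1` forces a weakly graded action to be graded: `G` scales `t`, `u_i`, `v_i`
(`exists_diagonal`), while `X` sends `t` to some `τ(t)` and multiplies each of `u_i`, `v_i` by a
polynomial in `t` (`exists_weights`). The relations of `A` with a single index then hold because the
matrices come from the action on `A_i`.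

What remains is the commutation of generators `w`, `w'` with different indices. Write `G t = a t`,
`w t = c t w`, `G w = b w`, `X w = r(t) w`. Applying `X` to `w t = c t w` gives `c (1 - a) t r(t) =
c τ(t) - b τ(c t)`. If `a ≠ 1`, this determines `r` from `b`, `c` and the common `a`, `τ`, and the
required identity between `r` and `r'` follows. If `a = 1`, then `G X = λ X G` gives `r = λ r`, so
`r = 0`. This is `Weight.cross`, used in `exists_glue`; agreement on `k[t]` is what makes `a` and
`τ` common.

The Taft relations on `A` need checking only on generators (`isTaft_of_adjoin`), and each generator
lies in some `A_i`. Inner-faithfulness is inherited from any one `A_i`. Comparing coefficients rests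
on the independence over `k[t]` of the powers of `u_i` and `v_i` (`mono_indep`), visible in a skew
Laurent representation. -/

namespace QGWA

/-! ### Defining relations and universal property of the quantum GWA. -/

variable {k : Type*} [Field k] {p : ℕ} {q : Fin p → k} {h : Fin p → k[X]}

lemma gen_u_mul_t (i : Fin p) :
    gen q h (.u i) * gen q h .t = q i • (gen q h .t * gen q h (.u i)) := by
  have := RingQuot.mkAlgHom_rel k (QGWARel.u_t (q := q) (h := h) i)
  rw [map_smul, map_mul, map_mul] at this
  exact this

lemma gen_v_mul_t (i : Fin p) :
    gen q h (.v i) * gen q h .t = (q i)⁻¹ • (gen q h .t * gen q h (.v i)) := by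
  have := RingQuot.mkAlgHom_rel k (QGWARel.v_t (q := q) (h := h) i)
  rw [map_smul, map_mul, map_mul] at this
  exact this

lemma gen_u_mul_v (i : Fin p) :
    gen q h (.u i) * gen q h (.v i) = Polynomial.aeval (q i • gen q h .t) (h i) := by
  have := RingQuot.mkAlgHom_rel k (QGWARel.u_v (q := q) (h := h) i)
  rw [map_mul, ← Polynomial.aeval_algHom_apply, map_smul] at this
  exact this

lemma gen_v_mul_u (i : Fin p) :
    gen q h (.v i) * gen q h (.u i) = Polynomial.aeval (gen q h .t) (h i) := by
  have := RingQuot.mkAlgHom_rel k (QGWARel.v_u (q := q) (h := h) i)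
  rw [map_mul, ← Polynomial.aeval_algHom_apply] at this
  exact this

lemma gen_u_comm {i j : Fin p} (hij : i ≠ j) :
    gen q h (.u i) * gen q h (.u j) = gen q h (.u j) * gen q h (.u i) := by
  have := RingQuot.mkAlgHom_rel k (QGWARel.comm_uu (q := q) (h := h) i j hij)
  rw [map_mul, map_mul] at this
  exact this

lemma gen_v_comm {i j : Fin p} (hij : i ≠ j) :
    gen q h (.v i) * gen q h (.v j) = gen q h (.v j) * gen q h (.v i) := by
  have := RingQuot.mkAlgHom_rel k (QGWARel.comm_vv (q := q) (h := h) i j hij)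
  rw [map_mul, map_mul] at this
  exact this

lemma gen_u_v_comm {i j : Fin p} (hij : i ≠ j) :
    gen q h (.u i) * gen q h (.v j) = gen q h (.v j) * gen q h (.u i) := by
  have := RingQuot.mkAlgHom_rel k (QGWARel.comm_uv (q := q) (h := h) i j hij)
  rw [map_mul, map_mul] at this
  exact this

variable (q h) in
/-- A family of elements satisfying the defining relations of the quantum GWA. -/
structure Satisfies {B : Type*} [Ring B] [Algebra k B] (f : QGWAGen p → B) : Prop where
  u_t : ∀ i, f (.u i) * f .t = q i • (f .t * f (.u i))
  v_t : ∀ i, f (.v i) * f .t = (q i)⁻¹ • (f .t * f (.v i))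
  u_v : ∀ i, f (.u i) * f (.v i) = Polynomial.aeval (q i • f .t) (h i)
  v_u : ∀ i, f (.v i) * f (.u i) = Polynomial.aeval (f .t) (h i)
  comm_uu : ∀ i j, i ≠ j → f (.u i) * f (.u j) = f (.u j) * f (.u i)
  comm_vv : ∀ i j, i ≠ j → f (.v i) * f (.v j) = f (.v j) * f (.v i)
  comm_uv : ∀ i j, i ≠ j → f (.u i) * f (.v j) = f (.v j) * f (.u i)

/-- The universal property of the presentation. -/
noncomputable def lift {B : Type*} [Ring B] [Algebra k B] (f : QGWAGen p → B)
    (hf : Satisfies q h f) : QGWA q h →ₐ[k] B :=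
  RingQuot.liftAlgHom k ⟨FreeAlgebra.lift k f, by
    intro a b r
    cases r with
    | u_t i => simpa using hf.u_t i
    | v_t i => simpa using hf.v_t i
    | u_v i => simpa [← Polynomial.aeval_algHom_apply] using hf.u_v i
    | v_u i => simpa [← Polynomial.aeval_algHom_apply] using hf.v_u i
    | comm_uu i j hij => simpa using hf.comm_uu i j hij
    | comm_vv i j hij => simpa using hf.comm_vv i j hij
    | comm_uv i j hij => simpa using hf.comm_uv i j hij⟩

@[simp] lemma lift_gen {B : Type*} [Ring B] [Algebra k B] (f : QGWAGen p → B)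
    (hf : Satisfies q h f) (a : QGWAGen p) : lift f hf (gen q h a) = f a := by
  simp only [lift, gen]
  erw [RingQuot.liftAlgHom_mkAlgHom_apply]
  simp

lemma adjoin_range_gen : Algebra.adjoin k (Set.range (gen q h)) = ⊤ := by
  have h1 : Set.range (gen q h) =
      RingQuot.mkAlgHom k (QGWARel q h) '' Set.range (FreeAlgebra.ι k (X := QGWAGen p)) := by
    rw [← Set.range_comp]; rfl
  have h2 := (RingQuot.mkAlgHom k (QGWARel q h)).map_adjoin (Set.range (FreeAlgebra.ι k))
  rw [FreeAlgebra.adjoin_range_ι, Algebra.map_top,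
    (AlgHom.range_eq_top _).2 (RingQuot.mkAlgHom_surjective k (QGWARel q h))] at h2
  rw [h1]
  exact h2.symm

/-- A property of elements of the quantum GWA that holds on the generators and is closed under the
algebra operations holds everywhere. -/
lemma induction {P : QGWA q h → Prop} (hc : ∀ c : k, P (algebraMap k (QGWA q h) c))
    (hg : ∀ a, P (gen q h a)) (hmul : ∀ a b, P a → P b → P (a * b))
    (hadd : ∀ a b, P a → P b → P (a + b)) (a : QGWA q h) : P a := by
  have ha : a ∈ Algebra.adjoin k (Set.range (gen q h)) := by
    rw [adjoin_range_gen]; exact Algebra.mem_top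
  induction ha using Algebra.adjoin_induction with
  | mem x hx => obtain ⟨y, rfl⟩ := hx; exact hg y
  | algebraMap r => exact hc r
  | add x y _ _ hx hy => exact hadd x y hx hy
  | mul x y _ _ hx hy => exact hmul x y hx hy

/-! ### Polynomials in `t` and the substitutions `t ↦ c t`. -/

variable (q h) in
/-- The polynomial `f(t)`. -/
noncomputable def poly : k[X] →ₐ[k] QGWA q h := Polynomial.aeval (gen q h .t)

/-- The substitution `t ↦ c t`. -/
noncomputable def dil (c : k) : k[X] →ₐ[k] k[X] := Polynomial.aeval (Polynomial.C c * Polynomial.X)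

lemma dil_apply (c : k) (f : k[X]) : dil c f = f.comp (Polynomial.C c * Polynomial.X) := rfl

@[simp] lemma dil_X (c : k) : dil c Polynomial.X = Polynomial.C c * Polynomial.X := by simp [dil]

@[simp] lemma dil_C (c a : k) : dil c (Polynomial.C a) = Polynomial.C a := by simp [dil]

lemma coeff_dil (c : k) (f : k[X]) (n : ℕ) : (dil c f).coeff n = f.coeff n * c ^ n := by
  rw [dil_apply, Polynomial.comp_C_mul_X_coeff]

lemma dil_dil (c d : k) (f : k[X]) : dil c (dil d f) = dil (c * d) f := by
  ext n; simp only [coeff_dil]; ring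

@[simp] lemma dil_one (f : k[X]) : dil 1 f = f := by ext n; simp [coeff_dil]

lemma dil_ne_zero {c : k} (hc : c ≠ 0) {f : k[X]} (hf : f ≠ 0) : dil c f ≠ 0 := by
  intro h0
  have := dil_dil c⁻¹ c f
  rw [h0, inv_mul_cancel₀ hc, dil_one, map_zero] at this
  exact hf this.symm

lemma natDegree_dil {c : k} (hc : c ≠ 0) (f : k[X]) : (dil c f).natDegree = f.natDegree := by
  rw [dil_apply, Polynomial.natDegree_comp, Polynomial.natDegree_C_mul_X _ hc, mul_one]

lemma poly_X : poly q h Polynomial.X = gen q h .t := by simp [poly]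

/-- An element `w` with `w t = c t w` satisfies `w f(t) = f(c t) w`. -/
lemma mul_poly {w : QGWA q h} {c : k} (hw : w * gen q h .t = c • (gen q h .t * w)) (f : k[X]) :
    w * poly q h f = poly q h (dil c f) * w := by
  induction f using Polynomial.induction_on' with
  | add f g hf hg => simp only [map_add, mul_add, add_mul, hf, hg]
  | monomial n a =>
    rw [← Polynomial.C_mul_X_pow_eq_monomial]
    simp only [map_mul, map_pow, dil_X, dil_C, poly_X]
    have hC : ∀ b : k, poly q h (Polynomial.C b) = algebraMap k _ b := fun b => by simp [poly]
    rw [hC, ← mul_assoc, ← Algebra.commutes, mul_assoc, mul_assoc]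
    congr 1
    rw [hC, ← Algebra.smul_def, smul_pow]
    clear hC
    induction n with
    | zero => simp
    | succ n ih =>
      rw [pow_succ, ← mul_assoc, ih, smul_mul_assoc, smul_mul_assoc, mul_assoc, hw, mul_smul_comm, smul_smul,
        pow_succ c, smul_mul_assoc, ← mul_assoc]

lemma u_mul_poly (i : Fin p) (f : k[X]) :
    gen q h (.u i) * poly q h f = poly q h (dil (q i) f) * gen q h (.u i) :=
  mul_poly (gen_u_mul_t i) f

lemma v_mul_poly (i : Fin p) (f : k[X]) :
    gen q h (.v i) * poly q h f = poly q h (dil (q i)⁻¹ f) * gen q h (.v i) :=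
  mul_poly (gen_v_mul_t i) f

lemma v_mul_u (i : Fin p) : gen q h (.v i) * gen q h (.u i) = poly q h (h i) := gen_v_mul_u i

lemma u_mul_v (i : Fin p) : gen q h (.u i) * gen q h (.v i) = poly q h (dil (q i) (h i)) := by
  rw [gen_u_mul_v, poly, dil, ← Polynomial.aeval_algHom_apply]
  simp [Algebra.smul_def]

/-! ### The representation by multiplication on a skew Laurent polynomial ring -/

section rep

/-- The operators by which the generators act on formal sums `∑ F(d) y ^ d`, where
`y_i t = q_i t y_i`, `u_i = y_i` and `v_i = h_i(t) y_i⁻¹`. -/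
noncomputable def repGen (q : Fin p → k) (h : Fin p → k[X]) :
    QGWAGen p → Module.End k ((Fin p → ℤ) → k[X])
  | .t => LinearMap.pi fun d => LinearMap.mulLeft k Polynomial.X ∘ₗ LinearMap.proj d
  | .u i => LinearMap.pi fun d => (dil (q i)).toLinearMap ∘ₗ LinearMap.proj (d - Pi.single i 1)
  | .v i => LinearMap.pi fun d => LinearMap.mulLeft k (h i) ∘ₗ (dil (q i)⁻¹).toLinearMap ∘ₗ
      LinearMap.proj (d + Pi.single i 1)

@[simp] lemma repGen_t (F : (Fin p → ℤ) → k[X]) (d : Fin p → ℤ) :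
    repGen q h .t F d = Polynomial.X * F d := rfl

@[simp] lemma repGen_u (i : Fin p) (F : (Fin p → ℤ) → k[X]) (d : Fin p → ℤ) :
    repGen q h (.u i) F d = dil (q i) (F (d - Pi.single i 1)) := rfl

@[simp] lemma repGen_v (i : Fin p) (F : (Fin p → ℤ) → k[X]) (d : Fin p → ℤ) :
    repGen q h (.v i) F d = h i * dil (q i)⁻¹ (F (d + Pi.single i 1)) := rfl

/-- A polynomial in a pointwise multiplication operator is a pointwise multiplication operator. -/
lemma aeval_apply_of_mul {ι : Type*} {T : Module.End k (ι → k[X])} {x : k[X]}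
    (hT : ∀ F d, T F d = x * F d) (f : k[X]) (F : ι → k[X]) (d : ι) :
    Polynomial.aeval T f F d = Polynomial.aeval x f * F d := by
  induction f using Polynomial.induction_on' with
  | add f g hf hg => simp [hf, hg, add_mul]
  | monomial n a =>
    simp only [Polynomial.aeval_monomial, Module.algebraMap_end_eq_smul_id, Module.End.mul_apply,
      LinearMap.smul_apply, LinearMap.id_apply, Pi.smul_apply]
    rw [← Algebra.smul_def, smul_mul_assoc]
    congr 1
    induction n generalizing F with
    | zero => simp
    | succ n ih => rw [pow_succ, Module.End.mul_apply, ih, hT, pow_succ, mul_assoc]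

/-- The operators for different indices commute because `h_j` is fixed by `t ↦ q_i t`, hence also by
the inverse substitution that `v_i` involves. -/
lemma repGen_satisfies (hq0 : ∀ i, q i ≠ 0) (hσ : ∀ i j, i ≠ j → dil (q i) (h j) = h j) :
    Satisfies q h (repGen q h) := by
  have hσ' : ∀ i j, i ≠ j → dil (q i)⁻¹ (h j) = h j := by
    intro i j hij
    conv_lhs => rw [← hσ i j hij, dil_dil, inv_mul_cancel₀ (hq0 i), dil_one]
  refine ⟨fun i => ?_, fun i => ?_, fun i => ?_, fun i => ?_, fun i j hij => ?_,
    fun i j hij => ?_, fun i j hij => ?_⟩ <;> refine LinearMap.ext fun F => funext fun d => ?_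
  · simp [Polynomial.smul_eq_C_mul, mul_assoc]
  · simp only [Module.End.mul_apply, repGen_v, repGen_t, map_mul, dil_X, LinearMap.smul_apply,
      Pi.smul_apply, Polynomial.smul_eq_C_mul]
    ring
  · rw [aeval_apply_of_mul (x := Polynomial.C (q i) * Polynomial.X)]
    · simp [dil_dil, mul_inv_cancel₀ (hq0 i)]
      exact Or.inl rfl
    · intro F d; simp [Polynomial.smul_eq_C_mul, mul_assoc]
  · rw [aeval_apply_of_mul (x := Polynomial.X) (by simp)]
    simp [dil_dil, inv_mul_cancel₀ (hq0 i)]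
  · simp [dil_dil, mul_comm, sub_right_comm]
  · simp only [Module.End.mul_apply, repGen_v, map_mul, dil_dil, hσ' _ _ hij, hσ' _ _ hij.symm,
      add_right_comm d, mul_comm (q i)⁻¹]
    ring
  · simp only [Module.End.mul_apply, repGen_v, repGen_u, map_mul, dil_dil, hσ _ _ hij,
      mul_comm (q i), sub_add_eq_add_sub]

end rep

/-! ### Symbols and their supports. -/

/-- The hypotheses on `q` and `h` that make the quantum GWA embed into a skew Laurent ring. -/
structure Admissible (q : Fin p → k) (h : Fin p → k[X]) : Prop where
  q_ne : ∀ i, q i ≠ 0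
  h_ne : ∀ i, h i ≠ 0
  dil_h : ∀ i j, i ≠ j → dil (q i) (h j) = h j

/-- The element of the skew Laurent ring given by an element of the quantum GWA. -/
noncomputable def symbol (H : Admissible q h) (a : QGWA q h) : (Fin p → ℤ) → k[X] :=
  lift (repGen q h) (repGen_satisfies H.q_ne H.dil_h) a (Pi.single 0 1)

variable (H : Admissible q h)

lemma symbol_one : symbol H 1 = Pi.single 0 1 := by simp [symbol]

lemma symbol_zero : symbol H 0 = 0 := by simp [symbol]

lemma symbol_add (a b : QGWA q h) : symbol H (a + b) = symbol H a + symbol H b := by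
  simp [symbol]

lemma symbol_smul (c : k) (a : QGWA q h) : symbol H (c • a) = c • symbol H a := by
  simp [symbol]

lemma symbol_gen_mul (x : QGWAGen p) (a : QGWA q h) :
    symbol H (gen q h x * a) = repGen q h x (symbol H a) := by
  simp [symbol]

lemma symbol_poly_mul (f : k[X]) (a : QGWA q h) (d : Fin p → ℤ) :
    symbol H (poly q h f * a) d = f * symbol H a d := by
  rw [symbol, map_mul, poly, ← Polynomial.aeval_algHom_apply, lift_gen, Module.End.mul_apply,
    aeval_apply_of_mul (x := Polynomial.X) (by simp)]
  simp [symbol]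

lemma poly_injective (H : Admissible q h) : Function.Injective (poly q h) := by
  intro f g hfg
  have h1 := symbol_poly_mul H f 1 0
  have h2 := symbol_poly_mul H g 1 0
  rw [hfg, h2] at h1
  simpa [symbol_one] using h1.symm

lemma symbol_word (w : List (QGWAGen p)) {d : Fin p → ℤ} (hd : d ≠ (w.map QGWAGen.deg).sum) :
    symbol H (w.map (gen q h)).prod d = 0 := by
  induction w generalizing d with
  | nil => simp only [List.map_nil, List.sum_nil] at hd; simp [symbol_one, hd]
  | cons x w ih =>
    rw [List.map_cons, List.prod_cons, symbol_gen_mul]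
    rw [List.map_cons, List.sum_cons] at hd
    cases x with
    | t => simp [ih (d := d) (by simpa [QGWAGen.deg] using hd)]
    | u i =>
      rw [repGen_u, ih, map_zero]
      intro h0; exact hd (by rw [← h0, QGWAGen.deg]; abel)
    | v i =>
      rw [repGen_v, ih, map_zero, mul_zero]
      intro h0; exact hd (by rw [← h0, QGWAGen.deg]; abel)

/-- A component is defined only as a span of words, so its independence from the others is not built
in. Symbols separate the components, since the symbol of a word is supported at the degree of the
word. -/
lemma symbol_component {d e : Fin p → ℤ} (hde : e ≠ d) {a : QGWA q h} (ha : a ∈ component q h d) :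
    symbol H a e = 0 := by
  induction ha using Submodule.span_induction with
  | mem x hx => obtain ⟨w, rfl, rfl⟩ := hx; exact symbol_word H w hde
  | zero => simp [symbol_zero]
  | add x y _ _ hx hy => simp [symbol_add, hx, hy]
  | smul c x _ hx => simp [symbol_smul, hx]

/-! ### Normal forms in the rank one subalgebras -/

variable (q h) in
/-- The monomial of degree `n` in `u_i`, `v_i`: `u_i ^ n` for `n ≥ 0` and `v_i ^ (-n)` otherwise. -/
noncomputable def mono (i : Fin p) : ℤ → QGWA q h
  | .ofNat n => gen q h (.u i) ^ n
  | .negSucc n => gen q h (.v i) ^ (n + 1)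

lemma mono_zero (i : Fin p) : mono q h i 0 = 1 := pow_zero _

lemma mono_one (i : Fin p) : mono q h i 1 = gen q h (.u i) := pow_one _

lemma mono_neg_one (i : Fin p) : mono q h i (-1) = gen q h (.v i) := pow_one _

lemma u_mul_mono (i : Fin p) (n : ℤ) :
    ∃ f, gen q h (.u i) * mono q h i n = poly q h f * mono q h i (n + 1) := by
  rcases n with n | n
  · exact ⟨1, by rw [map_one, one_mul]; exact (pow_succ' _ _).symm⟩
  · refine ⟨dil (q i) (h i), ?_⟩
    change _ * gen q h (.v i) ^ (n + 1) = _
    rw [pow_succ', ← mul_assoc, u_mul_v]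
    congr 1
    -- Cancelling the only factor `v_i` lands in degree `0`, where `mono` changes branch; this case
    -- is split off.
    rcases n with n | n
    · simp [mono]
    · rfl

lemma v_mul_mono (i : Fin p) (n : ℤ) :
    ∃ f, gen q h (.v i) * mono q h i n = poly q h f * mono q h i (n - 1) := by
  rcases n with (_ | n) | n
  · exact ⟨1, by simp [mono_zero, mono_neg_one]⟩
  · refine ⟨h i, ?_⟩
    change _ * gen q h (.u i) ^ (n + 1) = _
    rw [pow_succ', ← mul_assoc, v_mul_u]
    congr 1
    have : (Int.ofNat (n + 1) - 1) = Int.ofNat n := by simp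
    rw [this]; rfl
  · exact ⟨1, by rw [map_one, one_mul]; exact (pow_succ' _ _).symm⟩

variable (q h) in
/-- The map `F ↦ ∑ F_n(t) w_n`, where `w_n` is the monomial of degree `n` in `u_i`, `v_i`. -/
noncomputable def expand (i : Fin p) : (ℤ →₀ k[X]) →ₗ[k] QGWA q h :=
  Finsupp.lsum ℕ fun n => LinearMap.mulRight k (mono q h i n) ∘ₗ (poly q h).toLinearMap

lemma expand_apply (i : Fin p) (F : ℤ →₀ k[X]) :
    expand q h i F = F.sum fun n f => poly q h f * mono q h i n := by
  simp only [expand, Finsupp.lsum_apply]; rfl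

lemma expand_single (i : Fin p) (n : ℤ) (f : k[X]) :
    expand q h i (Finsupp.single n f) = poly q h f * mono q h i n := by
  simp [expand]

/-- The range of `expand` contains `1` and is stable under left multiplication by `t`, `u_i` and
`v_i`, hence by all of `A_i`. -/
lemma rankOne_le_range_expand (i : Fin p) {a : QGWA q h} (ha : a ∈ rankOne q h i) :
    ∃ F, expand q h i F = a := by
  have key : ∀ b, (∃ F, expand q h i F = b) → ∃ F, expand q h i F = a * b := by
    induction ha using Algebra.adjoin_induction with
    | mem x hx =>
      rintro _ ⟨F, rfl⟩
      induction F using Finsupp.induction_linear with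
      | zero => exact ⟨0, by simp⟩
      | add F F' hF hF' =>
        obtain ⟨E, hE⟩ := hF
        obtain ⟨E', hE'⟩ := hF'
        exact ⟨E + E', by rw [map_add, map_add, hE, hE', mul_add]⟩
      | single n f =>
        rw [expand_single]
        rcases hx with rfl | rfl | rfl
        · exact ⟨Finsupp.single n (Polynomial.X * f), by
            rw [expand_single, map_mul, poly_X, mul_assoc]⟩
        · obtain ⟨g, hg⟩ := u_mul_mono (q := q) (h := h) i n
          exact ⟨Finsupp.single (n + 1) (dil (q i) f * g), by
            rw [expand_single, ← mul_assoc, u_mul_poly, mul_assoc, hg, map_mul, mul_assoc]⟩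
        · obtain ⟨g, hg⟩ := v_mul_mono (q := q) (h := h) i n
          exact ⟨Finsupp.single (n - 1) (dil (q i)⁻¹ f * g), by
            rw [expand_single, ← mul_assoc, v_mul_poly, mul_assoc, hg, map_mul, mul_assoc]⟩
    | algebraMap r =>
      rintro _ ⟨F, rfl⟩
      exact ⟨r • F, by rw [map_smul, Algebra.smul_def]⟩
    | add x y _ _ hx hy =>
      intro b hb
      obtain ⟨E, hE⟩ := hx b hb
      obtain ⟨E', hE'⟩ := hy b hb
      exact ⟨E + E', by rw [map_add, hE, hE', add_mul]⟩
    | mul x y _ _ hx hy =>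
      intro b hb
      rw [mul_assoc]
      exact hx _ (hy b hb)
  simpa using key 1 ⟨Finsupp.single 0 1, by simp [expand_single, mono_zero]⟩

/-- In negative degrees the coefficient is a product of dilates of `h_i`. Its value is irrelevant:
being nonzero in a domain is enough for independence. -/
lemma symbol_mono (i : Fin p) (n : ℤ) :
    ∃ c ≠ 0, symbol H (mono q h i n) = Pi.single (Pi.single i n) c := by
  have hu : ∀ n : ℕ, symbol H (gen q h (.u i) ^ n) = Pi.single (Pi.single i (n : ℤ)) 1 := by
    intro n
    induction n with
    | zero => simp [symbol_one]
    | succ n ih =>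
      rw [pow_succ', symbol_gen_mul, ih]
      ext1 d
      rw [repGen_u]
      by_cases hd : d = Pi.single i ((n + 1 : ℕ) : ℤ)
      · subst hd
        rw [← Pi.single_sub]
        simp
      · rw [Pi.single_eq_of_ne hd, Pi.single_eq_of_ne, map_zero]
        intro h0
        exact hd (by rw [eq_add_of_sub_eq h0, ← Pi.single_add]; simp)
  have hv : ∀ n : ℕ, ∃ c ≠ 0, symbol H (gen q h (.v i) ^ n) =
      Pi.single (Pi.single i (-(n : ℤ))) c := by
    intro n
    induction n with
    | zero => exact ⟨1, one_ne_zero, by simp [symbol_one]⟩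
    | succ n ih =>
      obtain ⟨c, hc, ih⟩ := ih
      refine ⟨h i * dil (q i)⁻¹ c, mul_ne_zero (H.h_ne i)
        (dil_ne_zero (inv_ne_zero (H.q_ne i)) hc), ?_⟩
      rw [pow_succ', symbol_gen_mul, ih]
      ext1 d
      rw [repGen_v]
      by_cases hd : d = Pi.single i (-((n + 1 : ℕ) : ℤ))
      · subst hd
        rw [← Pi.single_add]
        simp
      · rw [Pi.single_eq_of_ne hd, Pi.single_eq_of_ne, map_zero, mul_zero]
        intro h0
        refine hd ?_
        rw [eq_sub_of_add_eq h0, ← Pi.single_sub]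
        congr 1
        push_cast; ring
  rcases n with n | n
  · exact ⟨1, one_ne_zero, hu n⟩
  · exact hv (n + 1)

/-- The monomials in `u_i`, `v_i` are linearly independent over `k[t]`. -/
lemma eq_zero_of_symbol_expand (H : Admissible q h) (i : Fin p) (F : ℤ →₀ k[X]) (n : ℤ)
    (hF : symbol H (expand q h i F) (Pi.single i n) = 0) : F n = 0 := by
  obtain ⟨c, hc, hcn⟩ := symbol_mono H i n
  have key : ∀ F : ℤ →₀ k[X], symbol H (expand q h i F) (Pi.single i n) = F n * c := by
    intro F
    induction F using Finsupp.induction_linear with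
    | zero => simp [symbol_zero]
    | add F F' hF hF' => simp [symbol_add, hF, hF', add_mul]
    | single m f =>
      rw [expand_single, symbol_poly_mul]
      by_cases hmn : m = n
      · subst hmn; simp [hcn]
      · obtain ⟨c', -, hc'⟩ := symbol_mono H i m
        rw [hc', Pi.single_eq_of_ne, Finsupp.single_eq_of_ne (Ne.symm hmn), mul_zero, zero_mul]
        exact fun h0 => hmn (Pi.single_injective i h0).symm
  rw [key] at hF
  exact (mul_eq_zero.1 hF).resolve_right hc

lemma mono_indep (H : Admissible q h) (i : Fin p) {F : ℤ →₀ k[X]} (hF : expand q h i F = 0) : F = 0 :=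
  Finsupp.ext fun n => eq_zero_of_symbol_expand H i F n (by rw [hF, symbol_zero]; rfl)

lemma expand_injective (H : Admissible q h) (i : Fin p) : Function.Injective (expand q h i) :=
  (injective_iff_map_eq_zero _).2 fun _ => mono_indep H i

lemma exists_of_mem_sup (H : Admissible q h) (i : Fin p) {N : ℤ} {a : rankOne q h i}
    (ha : a ∈ rankOneComponent q h i (-N) ⊔ rankOneComponent q h i N) :
    ∃ F : ℤ →₀ k[X], F.support ⊆ {-N, N} ∧ (a : QGWA q h) = expand q h i F := by
  obtain ⟨F, hF⟩ := rankOne_le_range_expand i a.2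
  refine ⟨F, ?_, hF.symm⟩
  obtain ⟨b, hb, c, hc, rfl⟩ := Submodule.mem_sup.1 ha
  intro n hn
  by_contra hne
  simp only [Finset.mem_insert, Finset.mem_singleton, not_or] at hne
  refine Finsupp.mem_support_iff.1 hn (eq_zero_of_symbol_expand H i F n ?_)
  rw [hF, Subalgebra.coe_add, symbol_add, Pi.add_apply,
    symbol_component H (fun h0 => hne.1 (Pi.single_injective i h0)) (a := b) hb,
    symbol_component H (fun h0 => hne.2 (Pi.single_injective i h0)) (a := c) hc, add_zero]

lemma exists_poly_of_mem (H : Admissible q h) (i : Fin p) {a : rankOne q h i}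
    (ha : a ∈ rankOneComponent q h i (-((0 : ℕ) : ℤ)) ⊔ rankOneComponent q h i ((0 : ℕ) : ℤ)) :
    ∃ f, (a : QGWA q h) = poly q h f := by
  obtain ⟨F, hF, h1⟩ := exists_of_mem_sup H i ha
  refine ⟨F 0, ?_⟩
  rw [h1, expand_apply, Finsupp.sum_of_support_subset F (s := {0}) (by simpa using hF)]
  · simp [mono_zero]
  · simp

lemma exists_u_v_of_mem (H : Admissible q h) (i : Fin p) {a : rankOne q h i}
    (ha : a ∈ rankOneComponent q h i (-((1 : ℕ) : ℤ)) ⊔ rankOneComponent q h i ((1 : ℕ) : ℤ)) :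
    ∃ f g, (a : QGWA q h) = poly q h f * gen q h (.u i) + poly q h g * gen q h (.v i) := by
  obtain ⟨F, hF, h1⟩ := exists_of_mem_sup H i ha
  refine ⟨F 1, F (-1), ?_⟩
  rw [h1, expand_apply, Finsupp.sum_of_support_subset F (s := {-1, 1}) (by simpa using hF),
    Finset.sum_pair (by decide)]
  · rw [mono_one, mono_neg_one, add_comm]
  · simp

/-- Comparison of coefficients in degrees `±1`. -/
lemma u_v_ext (H : Admissible q h) (i : Fin p) {f g f' g' : k[X]}
    (hfg : poly q h f * gen q h (.u i) + poly q h g * gen q h (.v i) =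
      poly q h f' * gen q h (.u i) + poly q h g' * gen q h (.v i)) : f = f' ∧ g = g' := by
  rw [← mono_one, ← mono_neg_one, ← expand_single, ← expand_single, ← expand_single,
    ← expand_single, ← map_add, ← map_add] at hfg
  have h1 := expand_injective H i hfg
  constructor
  · simpa using DFunLike.congr_fun h1 1
  · simpa using DFunLike.congr_fun h1 (-1)

lemma u_ext (H : Admissible q h) (i : Fin p) {f f' : k[X]}
    (hf : poly q h f * gen q h (.u i) = poly q h f' * gen q h (.u i)) : f = f' :=
  (u_v_ext H i (g := 0) (g' := 0) (by simpa using hf)).1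

lemma v_ext (H : Admissible q h) (i : Fin p) {f f' : k[X]}
    (hf : poly q h f * gen q h (.v i) = poly q h f' * gen q h (.v i)) : f = f' :=
  (u_v_ext H i (f := 0) (f' := 0) (by simpa using hf)).2

/-- Comparison of coefficients in degrees `±2`. -/
lemma sq_ext (H : Admissible q h) (i : Fin p) {f g r : k[X]}
    (hfg : poly q h f * gen q h (.u i) ^ 2 + poly q h g * gen q h (.v i) ^ 2 = poly q h r) :
    f = 0 ∧ g = 0 := by
  have hu : gen q h (.u i) ^ 2 = mono q h i 2 := rfl
  have hv : gen q h (.v i) ^ 2 = mono q h i (-2) := rfl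
  have h0 : poly q h r = poly q h r * mono q h i 0 := by rw [mono_zero, mul_one]
  rw [h0, hu, hv, ← expand_single, ← expand_single, ← expand_single, ← map_add] at hfg
  have h1 := expand_injective H i hfg
  constructor
  · simpa using DFunLike.congr_fun h1 2
  · simpa using DFunLike.congr_fun h1 (-2)

end QGWA

/-! ### Skew derivations as actions of generalized Taft algebras. -/

/-- An algebra endomorphism `G` together with a `(G, id)`-derivation `X`. -/
structure SkewDer (k B : Type*) [Field k] [Ring B] [Algebra k B] where
  G : B →ₐ[k] B
  X : B →ₗ[k] B
  X_mul : ∀ a b, X (a * b) = G a * X b + X a * b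

namespace SkewDer

variable {k B : Type*} [Field k] [Ring B] [Algebra k B]

lemma X_one (S : SkewDer k B) : S.X 1 = 0 := by
  have := S.X_mul 1 1
  simpa using this

/-- The algebra homomorphism `a ↦ (G a, X a; 0, a)`. -/
def toMatrix (S : SkewDer k B) : B →ₐ[k] Matrix (Fin 2) (Fin 2) B :=
  AlgHom.ofLinearMap
    { toFun := fun a => !![S.G a, S.X a; 0, a]
      map_add' := fun a b => by ext i j; fin_cases i <;> fin_cases j <;> simp
      map_smul' := fun c a => by ext i j; fin_cases i <;> fin_cases j <;> simp }
    (by ext i j; fin_cases i <;> fin_cases j <;> simp [S.X_one])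
    (fun a b => by
      ext i j; fin_cases i <;> fin_cases j <;> simp [S.X_mul])

/-- A homomorphism to upper triangular matrices with lower right entry the identity comes from a
skew derivation. -/
def ofMatrix (Φ : B →ₐ[k] Matrix (Fin 2) (Fin 2) B) (h10 : ∀ a, Φ a 1 0 = 0)
    (h11 : ∀ a, Φ a 1 1 = a) : SkewDer k B where
  G := AlgHom.ofLinearMap
    { toFun := fun a => Φ a 0 0
      map_add' := fun a b => by simp
      map_smul' := fun c a => by simp }
    (by simp)
    (fun a b => by simp [Matrix.mul_apply, Fin.sum_univ_two, h10])
  X :=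
    { toFun := fun a => Φ a 0 1
      map_add' := fun a b => by simp
      map_smul' := fun c a => by simp }
  X_mul a b := by simp [Matrix.mul_apply, Fin.sum_univ_two, h11]

/-- Two skew derivations, on `B` and on a subalgebra, that are compatible on generators of the
subalgebra are compatible. -/
lemma compat_of_adjoin (S : SkewDer k B) {s : Set B} (R : SkewDer k (Algebra.adjoin k s))
    (hs : ∀ a (ha : a ∈ s), S.G a = R.G ⟨a, Algebra.subset_adjoin ha⟩ ∧
      S.X a = R.X ⟨a, Algebra.subset_adjoin ha⟩) (y : Algebra.adjoin k s) :
    S.G y = R.G y ∧ S.X y = R.X y := by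
  obtain ⟨y, hy⟩ := y
  induction hy using Algebra.adjoin_induction with
  | mem x hx => exact hs x hx
  | algebraMap r =>
    have h1 : (⟨algebraMap k B r, Subalgebra.algebraMap_mem _ r⟩ : Algebra.adjoin k s) =
        algebraMap k _ r := rfl
    rw [h1]
    simp [Algebra.algebraMap_eq_smul_one, X_one]
  | add a b ha hb ha' hb' =>
    have h1 : (⟨a + b, Subalgebra.add_mem _ ha hb⟩ : Algebra.adjoin k s) = ⟨a, ha⟩ + ⟨b, hb⟩ := rfl
    rw [h1]
    simp only [Subalgebra.coe_add, map_add] at ha' hb' ⊢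
    rw [ha'.1, ha'.2, hb'.1, hb'.2]
    exact ⟨rfl, rfl⟩
  | mul a b ha hb ha' hb' =>
    have h1 : (⟨a * b, Subalgebra.mul_mem _ ha hb⟩ : Algebra.adjoin k s) = ⟨a, ha⟩ * ⟨b, hb⟩ := rfl
    rw [h1]
    simp only [Subalgebra.coe_mul, Subalgebra.coe_add, map_mul, X_mul] at ha' hb' ⊢
    rw [ha'.1, ha'.2, hb'.1, hb'.2]
    exact ⟨rfl, rfl⟩

variable (S : SkewDer k B)

lemma G_pow_mul (n : ℕ) (a b : B) :
    (S.G.toLinearMap ^ n : Module.End k B) (a * b) =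
      (S.G.toLinearMap ^ n : Module.End k B) a * (S.G.toLinearMap ^ n : Module.End k B) b := by
  induction n generalizing a b with
  | zero => simp
  | succ n ih => simp only [pow_succ, Module.End.mul_apply, AlgHom.toLinearMap_apply, map_mul, ih]

lemma G_pow_algebraMap (n : ℕ) (c : k) :
    (S.G.toLinearMap ^ n : Module.End k B) (algebraMap k B c) = algebraMap k B c := by
  induction n with
  | zero => simp
  | succ n ih => simp only [pow_succ, Module.End.mul_apply, AlgHom.toLinearMap_apply,
      AlgHom.commutes, ih]

/-- `X` on `B ⊗ B`. -/
noncomputable def tensorX : Module.End k (B ⊗[k] B) :=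
  TensorProduct.map S.X LinearMap.id + TensorProduct.map S.G.toLinearMap S.X

lemma X_mul' (w : B ⊗[k] B) :
    S.X (LinearMap.mul' k B w) = LinearMap.mul' k B (S.tensorX w) := by
  induction w with
  | zero => simp
  | tmul a b => simp [tensorX, S.X_mul, add_comm]
  | add y z hy hz => simp [hy, hz]

/-- `tensorX` is a sum of two operators that commute up to `l`, so the quantum binomial theorem at a
primitive root of unity leaves only their `m`-th powers. The resulting product rule lets the
vanishing of `X ^ m` be tested on algebra generators. -/
lemma X_pow_mul {l : k} {m : ℕ} (hm : 0 < m) (hl : IsPrimitiveRoot l m)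
    (hGX : S.G.toLinearMap * S.X = l • (S.X * S.G.toLinearMap : Module.End k B)) (a b : B) :
    (S.X ^ m : Module.End k B) (a * b) =
      (S.X ^ m : Module.End k B) a * b +
        (S.G.toLinearMap ^ m : Module.End k B) a * (S.X ^ m : Module.End k B) b := by
  have key : ∀ (j : ℕ) (w : B ⊗[k] B), (S.X ^ j : Module.End k B) (LinearMap.mul' k B w) =
      LinearMap.mul' k B ((S.tensorX ^ j) w) := by
    intro j
    induction j with
    | zero => simp
    | succ j ih => intro w; rw [pow_succ, pow_succ, Module.End.mul_apply, X_mul', ih]; rfl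
  have h1 := key m (a ⊗ₜ b)
  rw [LinearMap.mul'_apply, tensorX, TaftAlgebra.add_pow_prim hm hl, TensorProduct.map_pow,
    TensorProduct.map_pow] at h1
  · rw [h1]
    have : (LinearMap.id ^ m : Module.End k B) = 1 := one_pow m
    simp [this]
  · rw [← TensorProduct.map_mul, ← TensorProduct.map_mul, hGX, TensorProduct.map_smul_left]
    rfl

/-- The relations of the generalized Taft algebra for `G` and `X`. -/
structure IsTaft (D : TaftDatum k) : Prop where
  g_pow : (S.G.toLinearMap ^ D.n : Module.End k B) = 1
  x_pow : (S.X ^ D.m : Module.End k B) = 0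
  g_x : S.G.toLinearMap * S.X = D.lam • (S.X * S.G.toLinearMap : Module.End k B)

/-- It suffices to check the relations of the generalized Taft algebra on algebra generators. -/
lemma isTaft_of_adjoin (D : TaftDatum k) {s : Set B} (hs : Algebra.adjoin k s = ⊤)
    (hg : ∀ a ∈ s, (S.G.toLinearMap ^ D.n : Module.End k B) a = a)
    (hx : ∀ a ∈ s, (S.X ^ D.m : Module.End k B) a = 0)
    (hgx : ∀ a ∈ s, S.G (S.X a) = D.lam • S.X (S.G a)) : S.IsTaft D := by
  have hmem : ∀ a : B, a ∈ Algebra.adjoin k s := fun a => hs ▸ Algebra.mem_top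
  have hm : 0 < D.m := zero_lt_one.trans D.one_lt_m
  -- This relation comes first because the product rule for `X ^ m` depends on it.
  have hGX : S.G.toLinearMap * S.X = D.lam • (S.X * S.G.toLinearMap : Module.End k B) := by
    refine LinearMap.ext fun a => ?_
    change S.G (S.X a) = D.lam • S.X (S.G a)
    induction hmem a using Algebra.adjoin_induction with
    | mem x hx => exact hgx x hx
    | algebraMap r => simp [Algebra.algebraMap_eq_smul_one, X_one]
    | add x y _ _ hx hy => simp only [map_add, hx, hy, smul_add]
    | mul x y _ _ hx hy =>
      simp only [X_mul, map_add, map_mul, hx, hy, smul_add, mul_smul_comm, smul_mul_assoc]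
  refine ⟨LinearMap.ext fun a => ?_, LinearMap.ext fun a => ?_, hGX⟩
  · induction hmem a using Algebra.adjoin_induction with
    | mem x hx => exact hg x hx
    | algebraMap r => exact S.G_pow_algebraMap _ r
    | add x y _ _ hx hy => simp only [map_add, hx, hy]
    | mul x y _ _ hx hy => rw [G_pow_mul, hx, hy]; rfl
  · induction hmem a using Algebra.adjoin_induction with
    | mem x h1 => exact hx x h1
    | algebraMap r =>
      obtain ⟨j, hj⟩ : ∃ j, D.m = j + 1 := ⟨D.m - 1, by omega⟩
      rw [hj, pow_succ, Module.End.mul_apply, Algebra.algebraMap_eq_smul_one, map_smul, X_one]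
      simp
    | add x y _ _ hx hy => rw [map_add, hx, hy]; simp
    | mul x y _ _ hx hy => rw [S.X_pow_mul hm D.prim hGX, hx, hy]; simp

variable {S} {D : TaftDatum k} (hS : S.IsTaft D)

/-- The homomorphism from the generalized Taft algebra to the linear endomorphisms. -/
noncomputable def act : TaftAlgebra D →ₐ[k] Module.End k B :=
  TaftAlgebra.lift S.G.toLinearMap S.X hS.g_pow hS.x_pow hS.g_x

lemma act_g : act hS (TaftAlgebra.g D) = S.G.toLinearMap := TaftAlgebra.lift_g _ _ _ _ _

lemma act_x : act hS (TaftAlgebra.x D) = S.X := TaftAlgebra.lift_x _ _ _ _ _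

/-- The module algebra structure given by a pair `(G, X)` satisfying the Taft relations. -/
noncomputable def toModuleAlgebraStr : ModuleAlgebraStr k (TaftAlgebra D) B where
  act := act hS
  act_one a := by
    change _ = TaftAlgebra.counitHom D a • (1 : B)
    induction a using TaftAlgebra.induction with
    | hc c => simp [Algebra.algebraMap_eq_smul_one]
    | hg => simp [act_g]
    | hx => simp [act_x, X_one]
    | hmul a b ha hb => rw [map_mul, Module.End.mul_apply, hb, map_smul, ha, map_mul, smul_smul,
        mul_comm]
    | hadd a b ha hb => rw [map_add, LinearMap.add_apply, ha, hb, map_add, add_smul]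
  act_mul a b c := by
    let E : TaftAlgebra D ⊗[k] TaftAlgebra D →ₐ[k] Module.End k (B ⊗[k] B) :=
      (Module.endTensorEndAlgHom (R := k) (S := k) (A := k) (M := B) (N := B)).comp
        (Algebra.TensorProduct.map (act hS) (act hS))
    have hE : ∀ r s : TaftAlgebra D,
        E (r ⊗ₜ s) = TensorProduct.map (act hS r) (act hS s) := fun r s => rfl
    -- Arbitrary tensors `w`, rather than only `b ⊗ c`, are needed to compose the induction
    -- hypotheses for the two factors of a product in the Taft algebra.
    have key : ∀ w : B ⊗[k] B, act hS a (LinearMap.mul' k B w) =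
        LinearMap.mul' k B (E (TaftAlgebra.comulHom D a) w) := by
      induction a using TaftAlgebra.induction with
      | hc c =>
        intro w
        rw [AlgHom.commutes, AlgHom.commutes, AlgHom.commutes]
        simp [Algebra.algebraMap_eq_smul_one]
      | hg =>
        intro w
        rw [TaftAlgebra.comulHom_g, hE, act_g]
        induction w with
        | zero => simp
        | tmul a b => simp
        | add y z hy hz => simp only [map_add, hy, hz]
      | hx =>
        intro w
        rw [TaftAlgebra.comulHom_x, map_add, hE, hE, act_g, act_x, map_one, X_mul', tensorX,
          add_comm]
        rfl
      | hmul r s hr hs =>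
        intro w
        rw [map_mul, Module.End.mul_apply, hs, hr, map_mul, map_mul, Module.End.mul_apply]
      | hadd r s hr hs =>
        intro w
        rw [map_add, LinearMap.add_apply, hr, hs, map_add, map_add, LinearMap.add_apply, map_add]
    have h2 : ∀ z : TaftAlgebra D ⊗[k] TaftAlgebra D,
        TensorProduct.map ((act hS).toLinearMap.flip b) ((act hS).toLinearMap.flip c) z =
          E z (b ⊗ₜ c) := by
      intro z
      induction z with
      | zero => simp
      | tmul r s => rw [hE]; simp
      | add y z hy hz => rw [map_add, hy, hz, map_add, LinearMap.add_apply]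
    rw [h2]
    have h3 := key (b ⊗ₜ c)
    rw [LinearMap.mul'_apply] at h3
    exact h3

end SkewDer

/-! ### From module algebras back to skew derivations. -/

namespace ModuleAlgebraStr

variable {k B : Type*} [Field k] [Ring B] [Algebra k B] {D : TaftDatum k}

/-- The actions of `g` and `x` in a module algebra over a generalized Taft algebra. -/
noncomputable def toSkewDer (ρ : ModuleAlgebraStr k (TaftAlgebra D) B) : SkewDer k B where
  G := AlgHom.ofLinearMap (ρ.act (TaftAlgebra.g D))
    (by
      rw [ρ.act_one]
      change TaftAlgebra.counitHom D _ • _ = _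
      simp)
    (fun a b => by
      rw [ρ.act_mul]
      change LinearMap.mul' k B (TensorProduct.map _ _ (TaftAlgebra.comulHom D _)) = _
      simp)
  X := ρ.act (TaftAlgebra.x D)
  X_mul a b := by
    rw [ρ.act_mul]
    change LinearMap.mul' k B (TensorProduct.map _ _ (TaftAlgebra.comulHom D _)) = _
    simp

variable (ρ : ModuleAlgebraStr k (TaftAlgebra D) B)

lemma toSkewDer_isTaft : ρ.toSkewDer.IsTaft D where
  g_pow := by
    change ρ.act (TaftAlgebra.g D) ^ D.n = 1
    rw [← map_pow, TaftAlgebra.g_pow, map_one]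
  x_pow := by
    change ρ.act (TaftAlgebra.x D) ^ D.m = 0
    rw [← map_pow, TaftAlgebra.x_pow, map_zero]
  g_x := by
    change ρ.act (TaftAlgebra.g D) * ρ.act (TaftAlgebra.x D) =
      D.lam • (ρ.act (TaftAlgebra.x D) * ρ.act (TaftAlgebra.g D))
    rw [← map_mul, TaftAlgebra.g_mul_x, map_smul, map_mul]

end ModuleAlgebraStr

namespace QGWA

open Polynomial (C X)

variable {k : Type*} [Field k] {p : ℕ} {q : Fin p → k} {h : Fin p → k[X]}

/-! ### Components -/

lemma one_mem_component : (1 : QGWA q h) ∈ component q h 0 :=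
  Submodule.subset_span ⟨[], by simp, by simp⟩

lemma gen_mul_mem_component (x : QGWAGen p) {d : Fin p → ℤ} {a : QGWA q h}
    (ha : a ∈ component q h d) : gen q h x * a ∈ component q h (x.deg + d) := by
  induction ha using Submodule.span_induction with
  | mem y hy =>
    obtain ⟨w, rfl, rfl⟩ := hy
    exact Submodule.subset_span ⟨x :: w, by simp, by simp⟩
  | zero => simp
  | add y z _ _ hy hz => rw [mul_add]; exact add_mem hy hz
  | smul c y _ hy => rw [mul_smul_comm]; exact Submodule.smul_mem _ c hy

lemma gen_mem_component (x : QGWAGen p) : gen q h x ∈ component q h x.deg := by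
  simpa using gen_mul_mem_component x one_mem_component

lemma poly_mul_mem_component (f : k[X]) {d : Fin p → ℤ} {a : QGWA q h}
    (ha : a ∈ component q h d) : poly q h f * a ∈ component q h d := by
  induction f using Polynomial.induction_on' with
  | add f g hf hg => rw [map_add, add_mul]; exact add_mem hf hg
  | monomial n c =>
    rw [poly, Polynomial.aeval_monomial, ← Algebra.smul_def, smul_mul_assoc]
    refine Submodule.smul_mem _ c ?_
    induction n with
    | zero => simpa using ha
    | succ n ih =>
      rw [pow_succ', mul_assoc]
      simpa [QGWAGen.deg] using gen_mul_mem_component .t ih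

lemma poly_mem_component (f : k[X]) : poly q h f ∈ component q h 0 := by
  simpa using poly_mul_mem_component f one_mem_component

/-! ### The rank one subalgebras -/

variable (q h) in
/-- The element `u_i` of `A_i`. -/
def rankOneU (i : Fin p) : rankOne q h i :=
  ⟨gen q h (.u i), Algebra.subset_adjoin (by simp)⟩

variable (q h) in
/-- The element `v_i` of `A_i`. -/
def rankOneV (i : Fin p) : rankOne q h i :=
  ⟨gen q h (.v i), Algebra.subset_adjoin (by simp)⟩

variable (q h) in
/-- The element `f(t)` of `A_i`. -/
noncomputable def rankOnePoly (i : Fin p) : k[X] →ₐ[k] rankOne q h i :=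
  Polynomial.aeval (rankOneT q h i)

lemma coe_rankOnePoly (i : Fin p) (f : k[X]) : (rankOnePoly q h i f : QGWA q h) = poly q h f := by
  have := Polynomial.aeval_algHom_apply (rankOne q h i).val (rankOneT q h i) f
  exact this.symm

lemma rankOnePoly_X (i : Fin p) : rankOnePoly q h i X = rankOneT q h i := by simp [rankOnePoly]

lemma coe_rankOneT (i : Fin p) : (rankOneT q h i : QGWA q h) = gen q h .t := rfl

lemma coe_rankOneU (i : Fin p) : (rankOneU q h i : QGWA q h) = gen q h (.u i) := rfl

lemma coe_rankOneV (i : Fin p) : (rankOneV q h i : QGWA q h) = gen q h (.v i) := rfl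

lemma rankOneU_mul_T (i : Fin p) :
    rankOneU q h i * rankOneT q h i = q i • (rankOneT q h i * rankOneU q h i) :=
  Subtype.ext (gen_u_mul_t i)

lemma rankOneV_mul_T (i : Fin p) :
    rankOneV q h i * rankOneT q h i = (q i)⁻¹ • (rankOneT q h i * rankOneV q h i) :=
  Subtype.ext (gen_v_mul_t i)

lemma rankOneV_mul_U (i : Fin p) :
    rankOneV q h i * rankOneU q h i = rankOnePoly q h i (h i) :=
  Subtype.ext (by rw [coe_rankOnePoly]; exact v_mul_u i)

lemma rankOnePoly_mem (i : Fin p) (f : k[X]) :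
    rankOnePoly q h i f ∈ rankOneComponent q h i (-((0 : ℕ) : ℤ)) ⊔
      rankOneComponent q h i ((0 : ℕ) : ℤ) := by
  refine Submodule.mem_sup_right ?_
  change (rankOnePoly q h i f : QGWA q h) ∈ component q h (Pi.single i ((0 : ℕ) : ℤ))
  rw [coe_rankOnePoly, Nat.cast_zero, Pi.single_zero]
  exact poly_mem_component f

lemma rankOneU_mem (i : Fin p) :
    rankOneU q h i ∈ rankOneComponent q h i (-((1 : ℕ) : ℤ)) ⊔
      rankOneComponent q h i ((1 : ℕ) : ℤ) :=
  Submodule.mem_sup_right (gen_mem_component (q := q) (h := h) (.u i))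

lemma rankOneV_mem (i : Fin p) :
    rankOneV q h i ∈ rankOneComponent q h i (-((1 : ℕ) : ℤ)) ⊔
      rankOneComponent q h i ((1 : ℕ) : ℤ) := by
  refine Submodule.mem_sup_left ?_
  have h1 := gen_mem_component (q := q) (h := h) (.v i)
  rw [QGWAGen.deg, ← Pi.single_neg] at h1
  exact h1

/-! ### Polynomial identities -/

/-- The identities between the eigenvalue `a` and the polynomial `τ` that describe an action on `t`
and the eigenvalue `b` and the polynomial `r` that describe it on `w` with `w t = c t w`. -/
structure Weight (a : k) (τ : k[X]) (c b : k) (r : k[X]) : Prop where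
  c_ne : c ≠ 0
  rel : C b * dil c τ + C c * X * r = C c * (C a * X * r + τ)
  eq_zero : a = 1 → r = 0

/-- This is the upper right entry of the commutation of two triangular matrices. For `a ≠ 1`,
solving `rel` for `r` and `r'` expresses both sides through `τ(t)`, `τ(c t)`, `τ(c' t)` and `τ(c c'
t)`, and the terms cancel in pairs; for `a = 1` both polynomials vanish. -/
lemma Weight.cross {a : k} {τ : k[X]} {c b c' b' : k} {r r' : k[X]} (W : Weight a τ c b r)
    (W' : Weight a τ c' b' r') : C b * dil c r' + r = C b' * dil c' r + r' := by
  by_cases ha : a = 1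
  · rw [W.eq_zero ha, W'.eq_zero ha]; simp
  have h1 := W.rel
  have h2 := W'.rel
  have h1' := congrArg (dil c') h1
  have h2' := congrArg (dil c) h2
  simp only [map_add, map_mul, dil_C, dil_X, dil_dil] at h1' h2'
  rw [mul_comm c' c] at h1'
  -- This is the common denominator of `r`, `r'` and their dilates when they are written in terms of
  -- `τ`.
  have hne : C (1 - a) * X * C c * C c' ≠ 0 := by
    have h3 : C (1 - a) ≠ 0 := Polynomial.C_ne_zero.2 (sub_ne_zero.2 (Ne.symm ha))
    exact mul_ne_zero (mul_ne_zero (mul_ne_zero h3 Polynomial.X_ne_zero)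
      (Polynomial.C_ne_zero.2 W.c_ne)) (Polynomial.C_ne_zero.2 W'.c_ne)
  refine mul_left_cancel₀ hne ?_
  rw [map_sub, map_one]
  linear_combination C b * h2' - C b' * h1' + C c' * h1 - C c * h2

/-- Cancelling `f` leaves `α(c' t) = c α(t)`; the coefficients of degree `1` and `0` give the two
conclusions. It is used with `α = G t` and `f` a coefficient of `G u_i` or `G v_i`. -/
lemma eq_of_mul_dil {f α : k[X]} {c c' : k} (hf : f ≠ 0) (hα : α.natDegree = 1)
    (hrel : f * dil c' α = C c * (α * f)) : c' = c ∧ (c ≠ 1 → α.coeff 0 = 0) := by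
  have h1 : dil c' α = C c * α := mul_left_cancel₀ hf (by rw [hrel]; ring)
  have h2 : α.coeff 1 ≠ 0 := by
    rw [← hα]
    refine Polynomial.leadingCoeff_ne_zero.2 ?_
    rintro rfl; simp at hα
  constructor
  · have := congrArg (fun f => Polynomial.coeff f 1) h1
    simp only [coeff_dil, Polynomial.coeff_C_mul, pow_one] at this
    exact mul_left_cancel₀ h2 (by rw [this, mul_comm])
  · intro hc
    have := congrArg (fun f => Polynomial.coeff f 0) h1
    simp only [coeff_dil, Polynomial.coeff_C_mul, pow_zero, mul_one] at this
    have h3 : (1 - c) * α.coeff 0 = 0 := by linear_combination this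
    exact (mul_eq_zero.1 h3).resolve_left (sub_ne_zero.2 hc.symm)

lemma poly_C_mul (b : k) (a : QGWA q h) : poly q h (C b) * a = b • a := by
  simp [poly, Algebra.smul_def]

/-- The identity obtained by applying a skew derivation to `w t = c t w`. -/
lemma poly_mul_eq_of_skew {w : QGWA q h} {a b c : k} {r τ : k[X]}
    (hw : w * gen q h .t = c • (gen q h .t * w))
    (hrel : b • w * poly q h τ + poly q h r * w * gen q h .t =
      c • (a • gen q h .t * (poly q h r * w) + poly q h τ * w)) :
    poly q h (C b * dil c τ + C c * X * r) * w = poly q h (C c * (C a * X * r + τ)) * w := by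
  have h1 : poly q h (C b * dil c τ + C c * X * r) * w =
      b • w * poly q h τ + poly q h r * w * gen q h .t := by
    rw [smul_mul_assoc, ← poly_X, mul_assoc (poly q h r), mul_poly hw, mul_poly hw, dil_X,
      mul_comm (C c * X), ← poly_C_mul]
    simp only [map_add, map_mul, add_mul, mul_assoc]
  rw [h1, hrel, ← poly_X, ← poly_C_mul, ← poly_C_mul]
  simp only [map_add, map_mul, add_mul, mul_add, mul_assoc]

/-! ### Actions on the rank one subalgebras -/

section action

variable {i : Fin p} {S : SkewDer k (rankOne q h i)}

lemma gen_u_ne_zero (H : Admissible q h) (i : Fin p) : gen q h (.u i) ≠ 0 := by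
  intro h0
  have := u_ext H i (f := 1) (f' := 0) (by rw [h0]; simp)
  exact one_ne_zero this

lemma gen_v_ne_zero (H : Admissible q h) (i : Fin p) : gen q h (.v i) ≠ 0 := by
  intro h0
  have := v_ext H i (f := 1) (f' := 0) (by rw [h0]; simp)
  exact one_ne_zero this

lemma coe_G_poly {α : k[X]} (hα : (S.G (rankOneT q h i) : QGWA q h) = poly q h α) (f : k[X]) :
    (S.G (rankOnePoly q h i f) : QGWA q h) = poly q h (f.comp α) := by
  rw [rankOnePoly, ← Polynomial.aeval_algHom_apply]
  have h1 := Polynomial.aeval_algHom_apply (rankOne q h i).val (S.G (rankOneT q h i)) f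
  have h2 : (rankOne q h i).val (S.G (rankOneT q h i)) = poly q h α := hα
  rw [h2, Polynomial.aeval_algHom_apply] at h1
  exact h1.symm

/-- A weakly graded automorphism of finite order of a rank one quantum GWA is diagonal. -/
lemma exists_diagonal (H : Admissible q h) (hq1 : q i ≠ 1) (hqneg : q i ≠ -1)
    {n : ℕ} (hn : 0 < n)
    (hG : (S.G.toLinearMap ^ n : Module.End k _) = 1)
    (hst : ∀ (j : ℕ) (N : ℕ), ∀ a ∈ rankOneComponent q h i (-(N : ℤ)) ⊔ rankOneComponent q h i N,
      (S.G.toLinearMap ^ j : Module.End k _) a ∈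
        rankOneComponent q h i (-(N : ℤ)) ⊔ rankOneComponent q h i N) :
    ∃ a b c : k, a ≠ 0 ∧ b ≠ 0 ∧ c ≠ 0 ∧
      (S.G (rankOneT q h i) : QGWA q h) = a • gen q h .t ∧
      (S.G (rankOneU q h i) : QGWA q h) = b • gen q h (.u i) ∧
      (S.G (rankOneV q h i) : QGWA q h) = c • gen q h (.v i) := by
  have hinj : ∀ a, S.G a = 0 → a = 0 := by
    intro a ha
    obtain ⟨j, rfl⟩ : ∃ j, n = j + 1 := ⟨n - 1, by omega⟩
    have := LinearMap.congr_fun hG a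
    rw [pow_succ, Module.End.mul_apply, AlgHom.toLinearMap_apply, ha, map_zero] at this
    exact this.symm
  obtain ⟨α, hα⟩ := exists_poly_of_mem H i (hst 1 0 _ (rankOnePoly_mem i X))
  obtain ⟨β, hβ⟩ := exists_poly_of_mem H i (hst (n - 1) 0 _ (rankOnePoly_mem i X))
  obtain ⟨f₁, f₂, hu⟩ := exists_u_v_of_mem H i (hst 1 1 _ (rankOneU_mem i))
  obtain ⟨f₃, f₄, hv⟩ := exists_u_v_of_mem H i (hst 1 1 _ (rankOneV_mem i))
  rw [pow_one, AlgHom.toLinearMap_apply] at hα hu hv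
  rw [rankOnePoly_X] at hα
  -- `G ^ (n - 1)` inverts `G` and also preserves `k[t]`, so `α` has a compositional inverse and
  -- therefore degree one.
  have hαβ : β.comp α = X := by
    have h1 : (S.G.toLinearMap ^ (n - 1) : Module.End k _) (rankOnePoly q h i X) =
        rankOnePoly q h i β := Subtype.ext (by rw [hβ, coe_rankOnePoly])
    have h2 := LinearMap.congr_fun hG (rankOnePoly q h i X)
    rw [← Nat.sub_add_cancel hn, pow_succ', Module.End.mul_apply, h1,
      AlgHom.toLinearMap_apply] at h2
    have h3 := congrArg Subtype.val h2
    rw [coe_G_poly hα] at h3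
    refine poly_injective H (h3.trans ?_)
    rw [Module.End.one_apply, coe_rankOnePoly]
  have hdeg : α.natDegree = 1 := by
    have h1 := congrArg Polynomial.natDegree hαβ
    rw [Polynomial.natDegree_comp, Polynomial.natDegree_X] at h1
    exact Nat.eq_one_of_mul_eq_one_left h1
  have hut := congrArg (fun y => (S.G y : QGWA q h)) (rankOneU_mul_T (q := q) (h := h) i)
  have hvt := congrArg (fun y => (S.G y : QGWA q h)) (rankOneV_mul_T (q := q) (h := h) i)
  have hvu := congrArg (fun y => (S.G y : QGWA q h)) (rankOneV_mul_U (q := q) (h := h) i)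
  simp only [map_mul, map_smul, Subalgebra.coe_mul, Subalgebra.coe_smul, hα, hu, hv, add_mul,
    mul_add, mul_assoc, u_mul_poly, v_mul_poly, coe_G_poly hα, smul_add, ← poly_C_mul] at hut hvt hvu
  simp only [← mul_assoc, ← map_mul] at hut hvt
  obtain ⟨hut1, hut2⟩ := u_v_ext H i hut
  obtain ⟨hvt1, hvt2⟩ := u_v_ext H i hvt
  -- Moving `u_i` and `v_i` past `t` produces different scalars because `q_i ≠ ±1`. Hence `G` can
  -- neither mix nor exchange them.
  have hqq : q i ≠ (q i)⁻¹ := by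
    intro h0
    have h1 : q i * q i = 1 := by
      nth_rewrite 2 [h0]; exact mul_inv_cancel₀ (H.q_ne i)
    rcases mul_self_eq_one_iff.1 h1 with h2 | h2
    exacts [hq1 h2, hqneg h2]
  have hf₂ : f₂ = 0 := by
    by_contra hne
    exact hqq (eq_of_mul_dil hne hdeg (hut2.trans (by ring))).1.symm
  have hf₃ : f₃ = 0 := by
    by_contra hne
    exact hqq (eq_of_mul_dil hne hdeg (hvt1.trans (by ring))).1
  subst hf₂ hf₃
  simp only [map_zero, zero_mul, mul_zero, add_zero, zero_add] at hu hv hvu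
  have hf₁ : f₁ ≠ 0 := by
    rintro rfl
    have h1 := hinj (rankOneU q h i) (Subtype.ext (by rw [hu]; simp))
    exact gen_u_ne_zero H i (congrArg Subtype.val h1)
  have hf₄ : f₄ ≠ 0 := by
    rintro rfl
    have h1 := hinj (rankOneV q h i) (Subtype.ext (by rw [hv]; simp))
    exact gen_v_ne_zero H i (congrArg Subtype.val h1)
  have hα0 : α.coeff 0 = 0 := (eq_of_mul_dil hf₁ hdeg (hut1.trans (by ring))).2 hq1
  -- Applying `G` to `v_i u_i = h_i(t)` gives `f₄(t) f₁(t / q_i) h_i(t) = h_i(α(t))`. As `α` has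
  -- degree one, comparing degrees makes `f₁` and `f₄` constant.
  rw [← mul_assoc (gen q h (.v i)), v_mul_poly, mul_assoc, v_mul_u, ← map_mul, ← map_mul] at hvu
  have hdeg2 := congrArg Polynomial.natDegree (poly_injective H hvu)
  have hf₁' := dil_ne_zero (inv_ne_zero (H.q_ne i)) hf₁
  rw [Polynomial.natDegree_mul hf₄ (mul_ne_zero hf₁' (H.h_ne i)),
    Polynomial.natDegree_mul hf₁' (H.h_ne i), natDegree_dil (inv_ne_zero (H.q_ne i)),
    Polynomial.natDegree_comp, hdeg, mul_one] at hdeg2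
  obtain ⟨b, rfl⟩ := Polynomial.natDegree_eq_zero.1 (show f₁.natDegree = 0 by omega)
  obtain ⟨c, rfl⟩ := Polynomial.natDegree_eq_zero.1 (show f₄.natDegree = 0 by omega)
  have hαa : α = C (α.coeff 1) * X := by
    rw [Polynomial.eq_X_add_C_of_natDegree_le_one hdeg.le, hα0]
    simp
  refine ⟨α.coeff 1, b, c, ?_, ?_, ?_, ?_, ?_, ?_⟩
  · intro h0
    rw [h0] at hαa
    rw [hαa] at hdeg
    simp at hdeg
  · rintro rfl; simp at hf₁
  · rintro rfl; simp at hf₄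
  · rw [hα, hαa, map_mul, poly_C_mul, poly_X]; simp
  · rw [hu, poly_C_mul]
  · rw [hv, poly_C_mul]

/-- A weakly graded action of a generalized Taft algebra on a rank one quantum GWA is graded. -/
lemma exists_weights (H : Admissible q h) (hq1 : q i ≠ 1) (hqneg : q i ≠ -1) {D : TaftDatum k}
    (ρ : ModuleAlgebraStr k (TaftAlgebra D) (rankOne q h i))
    (hρ : ρ.WeaklyGraded (rankOneComponent q h i)) :
    ∃ (a : k) (τ : k[X]),
      (ρ.toSkewDer.G (rankOneT q h i) : QGWA q h) = a • gen q h .t ∧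
      (ρ.toSkewDer.X (rankOneT q h i) : QGWA q h) = poly q h τ ∧
      (∃ b r, Weight a τ (q i) b r ∧
        (ρ.toSkewDer.G (rankOneU q h i) : QGWA q h) = b • gen q h (.u i) ∧
        (ρ.toSkewDer.X (rankOneU q h i) : QGWA q h) = poly q h r * gen q h (.u i)) ∧
      ∃ b r, Weight a τ (q i)⁻¹ b r ∧
        (ρ.toSkewDer.G (rankOneV q h i) : QGWA q h) = b • gen q h (.v i) ∧
        (ρ.toSkewDer.X (rankOneV q h i) : QGWA q h) = poly q h r * gen q h (.v i) := by
  set S := ρ.toSkewDer with hS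
  have hT : S.IsTaft D := ρ.toSkewDer_isTaft
  obtain ⟨a, b, c, ha, hb, hc, hGt, hGu, hGv⟩ := exists_diagonal (S := S) H hq1 hqneg D.n_pos
    hT.g_pow (fun j N y hy => by
      have := hρ N (TaftAlgebra.g D ^ j) y hy
      rwa [map_pow] at this)
  have hX : ∀ N : ℕ, ∀ y ∈ rankOneComponent q h i (-(N : ℤ)) ⊔ rankOneComponent q h i N,
      S.X y ∈ rankOneComponent q h i (-(N : ℤ)) ⊔ rankOneComponent q h i N :=
    fun N y hy => hρ N (TaftAlgebra.x D) y hy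
  obtain ⟨τ, hXt⟩ := exists_poly_of_mem H i (hX 0 _ (rankOnePoly_mem i X))
  obtain ⟨e, hXh⟩ := exists_poly_of_mem H i (hX 0 _ (rankOnePoly_mem i (h i)))
  obtain ⟨r, s, hXu⟩ := exists_u_v_of_mem H i (hX 1 _ (rankOneU_mem i))
  obtain ⟨s', r', hXv⟩ := exists_u_v_of_mem H i (hX 1 _ (rankOneV_mem i))
  rw [rankOnePoly_X] at hXt
  have hvu := congrArg (fun y => (S.X y : QGWA q h)) (rankOneV_mul_U (q := q) (h := h) i)
  simp only [S.X_mul, Subalgebra.coe_add, Subalgebra.coe_mul, hGv, hXu, hXv, hXh,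
    coe_rankOneU] at hvu
  have hs : s' = 0 ∧ C c * dil (q i)⁻¹ s = 0 := by
    -- Since `X (v_i u_i) = X (h_i(t))` lies in `k[t]`, the parts of `X u_i` along `v_i` and of `X
    -- v_i` along `u_i` must vanish: they would contribute `v_i ^ 2` and `u_i ^ 2`. The polynomial
    -- given here collects the terms of degree zero.
    refine sq_ext H i (r := e - C c * (dil (q i)⁻¹ r * h i) - r' * h i) ?_
    rw [map_sub, map_sub, ← hvu]
    simp only [map_mul, mul_add, add_mul, mul_assoc, poly_C_mul, smul_mul_assoc, sq]
    rw [← mul_assoc (gen q h (.v i)) (poly q h r), ← mul_assoc (gen q h (.v i)) (poly q h s),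
      v_mul_poly, v_mul_poly, mul_assoc, mul_assoc, v_mul_u]
    abel
  obtain ⟨rfl, hs2⟩ := hs
  have hs0 : s = 0 := by
    by_contra hne
    exact mul_ne_zero (Polynomial.C_ne_zero.2 hc)
      (dil_ne_zero (inv_ne_zero (H.q_ne i)) hne) hs2
  subst hs0
  simp only [map_zero, zero_mul, add_zero, zero_add] at hXu hXv
  have hGP : ∀ f, (S.G (rankOnePoly q h i f) : QGWA q h) = poly q h (dil a f) := by
    intro f
    rw [coe_G_poly (α := C a * X), dil_apply]
    rw [hGt, map_mul, poly_C_mul, poly_X]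
  have hlam : D.lam ≠ 1 := D.prim.ne_one D.one_lt_m
  have hgx : ∀ y, (S.G (S.X y) : QGWA q h) = D.lam • (S.X (S.G y) : QGWA q h) := fun y =>
    congrArg Subtype.val (LinearMap.congr_fun hT.g_x y)
  have hXt' : S.X (rankOneT q h i) = rankOnePoly q h i τ :=
    Subtype.ext (by rw [hXt, coe_rankOnePoly])
  -- Evaluating `G X = λ X G` on `u_i` or `v_i` and cancelling the nonzero eigenvalue of `G` gives
  -- `r(a t) = λ r(t)`; for `a = 1` this forces `r = 0`, because `λ ≠ 1`.
  have hzero : ∀ f : k[X], dil a f = C D.lam * f → a = 1 → f = 0 := by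
    rintro f hf rfl
    rw [dil_one] at hf
    have h1 : C (1 - D.lam) * f = 0 := by rw [map_sub, map_one, sub_mul, one_mul, ← hf, sub_self]
    exact (mul_eq_zero.1 h1).resolve_left (Polynomial.C_ne_zero.2 (sub_ne_zero.2 hlam.symm))
  refine ⟨a, τ, hGt, hXt, ⟨b, r, ⟨H.q_ne i, ?_, hzero r ?_⟩, hGu, hXu⟩,
    c, r', ⟨inv_ne_zero (H.q_ne i), ?_, hzero r' ?_⟩, hGv, hXv⟩
  · have h1 := congrArg (fun y => (S.X y : QGWA q h)) (rankOneU_mul_T (q := q) (h := h) i)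
    simp only [S.X_mul, map_smul, Subalgebra.coe_add, Subalgebra.coe_mul, Subalgebra.coe_smul,
      hGu, hGt, hXu, hXt, coe_rankOneT, coe_rankOneU] at h1
    exact u_ext H i (poly_mul_eq_of_skew (gen_u_mul_t i) h1)
  · have hXu' : S.X (rankOneU q h i) = rankOnePoly q h i r * rankOneU q h i :=
      Subtype.ext (by rw [hXu, Subalgebra.coe_mul, coe_rankOnePoly]; rfl)
    have hGu' : S.G (rankOneU q h i) = b • rankOneU q h i := Subtype.ext hGu
    have h1 := hgx (rankOneU q h i)
    rw [hGu', map_smul, Subalgebra.coe_smul, hXu, hXu', map_mul, Subalgebra.coe_mul, hGP, hGu,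
      mul_smul_comm, smul_comm] at h1
    refine u_ext H i ?_
    rw [map_mul, mul_assoc, poly_C_mul]
    exact smul_right_injective _ hb h1
  · have h1 := congrArg (fun y => (S.X y : QGWA q h)) (rankOneV_mul_T (q := q) (h := h) i)
    simp only [S.X_mul, map_smul, Subalgebra.coe_add, Subalgebra.coe_mul, Subalgebra.coe_smul,
      hGv, hGt, hXv, hXt, coe_rankOneT, coe_rankOneV] at h1
    exact v_ext H i (poly_mul_eq_of_skew (gen_v_mul_t i) h1)
  · have hXv' : S.X (rankOneV q h i) = rankOnePoly q h i r' * rankOneV q h i :=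
      Subtype.ext (by rw [hXv, Subalgebra.coe_mul, coe_rankOnePoly]; rfl)
    have hGv' : S.G (rankOneV q h i) = c • rankOneV q h i := Subtype.ext hGv
    have h1 := hgx (rankOneV q h i)
    rw [hGv', map_smul, Subalgebra.coe_smul, hXv, hXv', map_mul, Subalgebra.coe_mul, hGP, hGv,
      mul_smul_comm, smul_comm] at h1
    refine v_ext H i ?_
    rw [map_mul, mul_assoc, poly_C_mul]
    exact smul_right_injective _ hc h1

end action

end QGWA

/-! ### Gluing the rank one actions. -/

namespace QGWA

variable {k : Type*} [Field k] {p : ℕ} {q : Fin p → k} {h : Fin p → k[X]}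

/-- The diagonal entries commute because `w` and `w'` do. In the corner, moving all polynomials to
the left of `w * w'` turns the claim into `Weight.cross`. -/
lemma matrix_mul_comm {w w' : QGWA q h} {a b c b' c' : k} {τ r r' : k[X]}
    (hw : w * gen q h .t = c • (gen q h .t * w)) (hw' : w' * gen q h .t = c' • (gen q h .t * w'))
    (hcomm : w * w' = w' * w) (W : Weight a τ c b r) (W' : Weight a τ c' b' r') :
    !![b • w, poly q h r * w; 0, w] * !![b' • w', poly q h r' * w'; 0, w'] =
      !![b' • w', poly q h r' * w'; 0, w'] * !![b • w, poly q h r * w; 0, w] := by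
  have key : ∀ {w w' : QGWA q h} {b c : k} {r r' : k[X]},
      w * gen q h .t = c • (gen q h .t * w) →
      b • w * (poly q h r' * w') + poly q h r * w * w' =
        poly q h (Polynomial.C b * dil c r' + r) * (w * w') := by
    intro w w' b c r r' hw
    rw [← mul_assoc, smul_mul_assoc, mul_poly hw, map_add, map_mul, ← poly_C_mul]
    simp only [add_mul, mul_assoc]
  rw [Matrix.mul_fin_two, Matrix.mul_fin_two]
  simp only [mul_zero, zero_mul, add_zero, zero_add]
  rw [key hw, key hw', W.cross W', hcomm, smul_mul_smul_comm, smul_mul_smul_comm, hcomm,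
    mul_comm b]

/-- Images of the generators under upper triangular matrices, for eigenvalues `a`, `b`, `c` and
polynomials `τ`, `r`, `s`. -/
noncomputable def diagMatrix (a : k) (τ : k[X]) (b c : Fin p → k) (r s : Fin p → k[X]) :
    QGWAGen p → Matrix (Fin 2) (Fin 2) (QGWA q h)
  | .t => !![a • gen q h .t, poly q h τ; 0, gen q h .t]
  | .u i => !![b i • gen q h (.u i), poly q h (r i) * gen q h (.u i); 0, gen q h (.u i)]
  | .v i => !![c i • gen q h (.v i), poly q h (s i) * gen q h (.v i); 0, gen q h (.v i)]

lemma compat_pow {i : Fin p} (f : Module.End k (QGWA q h)) (f' : Module.End k (rankOne q h i))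
    (hf : ∀ y : rankOne q h i, f y = f' y) (n : ℕ) (y : rankOne q h i) :
    (f ^ n) y = ((f' ^ n) y : rankOne q h i) := by
  induction n generalizing y with
  | zero => rfl
  | succ n ih => rw [pow_succ, pow_succ, Module.End.mul_apply, hf, ih]; rfl

/-- Diagonal actions of a generalized Taft algebra on the rank one subalgebras of a quantum GWA
glue to an action on the whole quantum GWA. -/
lemma exists_glue (hp : 0 < p) {D : TaftDatum k} (S : ∀ i, SkewDer k (rankOne q h i))
    (hS : ∀ i, (S i).IsTaft D) (a : k) (τ : k[X]) (b c : Fin p → k) (r s : Fin p → k[X])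
    (hGt : ∀ i, ((S i).G (rankOneT q h i) : QGWA q h) = a • gen q h .t)
    (hXt : ∀ i, ((S i).X (rankOneT q h i) : QGWA q h) = poly q h τ)
    (hu : ∀ i, Weight a τ (q i) (b i) (r i))
    (hGu : ∀ i, ((S i).G (rankOneU q h i) : QGWA q h) = b i • gen q h (.u i))
    (hXu : ∀ i, ((S i).X (rankOneU q h i) : QGWA q h) = poly q h (r i) * gen q h (.u i))
    (hv : ∀ i, Weight a τ (q i)⁻¹ (c i) (s i))
    (hGv : ∀ i, ((S i).G (rankOneV q h i) : QGWA q h) = c i • gen q h (.v i))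
    (hXv : ∀ i, ((S i).X (rankOneV q h i) : QGWA q h) = poly q h (s i) * gen q h (.v i)) :
    ∃ R : SkewDer k (QGWA q h), R.IsTaft D ∧
      (∀ i (y : rankOne q h i), R.G y = (S i).G y ∧ R.X y = (S i).X y) := by
  let Ψ : ∀ i, rankOne q h i →ₐ[k] Matrix (Fin 2) (Fin 2) (QGWA q h) := fun i =>
    (rankOne q h i).val.mapMatrix.comp (S i).toMatrix
  have hΨ : ∀ i y, Ψ i y = !![((S i).G y : QGWA q h), ((S i).X y : QGWA q h); 0, (y : QGWA q h)] := by
    intro i y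
    ext m n
    fin_cases m <;> fin_cases n <;> rfl
  have ht : ∀ i, diagMatrix a τ b c r s .t = Ψ i (rankOneT q h i) := fun i => by
    rw [hΨ, hGt, hXt]; rfl
  have hu' : ∀ i, diagMatrix a τ b c r s (.u i) = Ψ i (rankOneU q h i) := fun i => by
    rw [hΨ, hGu, hXu]; rfl
  have hv' : ∀ i, diagMatrix a τ b c r s (.v i) = Ψ i (rankOneV q h i) := fun i => by
    rw [hΨ, hGv, hXv]; rfl
  -- The first four relations involve one index and are carried over by `Ψ i` from `A_i`. Only the
  -- last three compare different indices, and they use that `a` and `τ` are shared.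
  have hsat : Satisfies q h (diagMatrix (q := q) (h := h) a τ b c r s) := by
    refine ⟨fun i => ?_, fun i => ?_, fun i => ?_, fun i => ?_, fun i j hij => ?_,
      fun i j hij => ?_, fun i j hij => ?_⟩
    · rw [ht i, hu', ← map_mul, ← map_mul, rankOneU_mul_T, map_smul]
    · rw [ht i, hv', ← map_mul, ← map_mul, rankOneV_mul_T, map_smul]
    · rw [ht i, hu', hv', ← map_mul, ← map_smul, Polynomial.aeval_algHom_apply]
      congr 1
      refine Subtype.ext ?_
      have := Polynomial.aeval_algHom_apply (rankOne q h i).val (q i • rankOneT q h i) (h i)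
      exact (gen_u_mul_v i).trans this
    · rw [ht i, hu', hv', ← map_mul, rankOneV_mul_U, Polynomial.aeval_algHom_apply]
      rfl
    · exact matrix_mul_comm (gen_u_mul_t i) (gen_u_mul_t j) (gen_u_comm hij) (hu i) (hu j)
    · exact matrix_mul_comm (gen_v_mul_t i) (gen_v_mul_t j) (gen_v_comm hij) (hv i) (hv j)
    · exact matrix_mul_comm (gen_u_mul_t i) (gen_v_mul_t j) (gen_u_v_comm hij) (hu i) (hv j)
  have h10 : ∀ y, lift _ hsat y 1 0 = 0 := by
    intro y
    induction y using QGWA.induction with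
    | hc c => simp [AlgHom.commutes, Matrix.algebraMap_matrix_apply]
    | hg x => rw [lift_gen]; cases x <;> rfl
    | hmul y z hy hz => rw [map_mul, Matrix.mul_apply, Fin.sum_univ_two, hy, hz]; simp
    | hadd y z hy hz => rw [map_add, Matrix.add_apply, hy, hz, add_zero]
  have h11 : ∀ y, lift _ hsat y 1 1 = y := by
    intro y
    induction y using QGWA.induction with
    | hc c => simp [AlgHom.commutes, Matrix.algebraMap_matrix_apply]
    | hg x => rw [lift_gen]; cases x <;> rfl
    | hmul y z hy hz => rw [map_mul, Matrix.mul_apply, Fin.sum_univ_two, hy, hz, h10]; simp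
    | hadd y z hy hz => rw [map_add, Matrix.add_apply, hy, hz]
  let R : SkewDer k (QGWA q h) := SkewDer.ofMatrix (lift _ hsat) h10 h11
  have hRG : ∀ x, R.G (gen q h x) = diagMatrix a τ b c r s x 0 0 := fun x => by
    rw [← lift_gen _ hsat]; rfl
  have hRX : ∀ x, R.X (gen q h x) = diagMatrix a τ b c r s x 0 1 := fun x => by
    rw [← lift_gen _ hsat]; rfl
  have hres : ∀ i (y : rankOne q h i), R.G y = (S i).G y ∧ R.X y = (S i).X y := by
    intro i
    refine SkewDer.compat_of_adjoin R (S i) ?_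
    rintro y (rfl | rfl | rfl) <;> rw [hRG, hRX]
    · exact ⟨(hGt i).symm, (hXt i).symm⟩
    · exact ⟨(hGu i).symm, (hXu i).symm⟩
    · exact ⟨(hGv i).symm, (hXv i).symm⟩
  -- The generator `t` carries no index; `0 < p` provides some `A_i` containing it.
  have hmem : ∀ x : QGWAGen p, ∃ i, ∃ y : rankOne q h i, gen q h x = y := by
    rintro (_ | i | i)
    · exact ⟨⟨0, hp⟩, rankOneT q h _, rfl⟩
    · exact ⟨i, rankOneU q h i, rfl⟩
    · exact ⟨i, rankOneV q h i, rfl⟩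
  refine ⟨R, R.isTaft_of_adjoin D adjoin_range_gen ?_ ?_ ?_, hres⟩ <;> rintro _ ⟨x, rfl⟩ <;>
    obtain ⟨i, y, hy⟩ := hmem x <;> rw [hy]
  · rw [compat_pow _ (S i).G.toLinearMap (fun y => (hres i y).1), (hS i).g_pow]
    rfl
  · rw [compat_pow _ (S i).X (fun y => (hres i y).2), (hS i).x_pow]
    rfl
  · rw [(hres i y).2, (hres i _).1, (hres i y).1, (hres i _).2]
    exact congrArg Subtype.val (LinearMap.congr_fun (hS i).g_x y)

/-- A skew derivation that is diagonal on the generators preserves all components. -/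
lemma stable_component (R : SkewDer k (QGWA q h)) (hG : ∀ x, ∃ b : k, R.G (gen q h x) = b • gen q h x)
    (hXu : ∀ i, ∃ r, R.X (gen q h (.u i)) = poly q h r * gen q h (.u i))
    (hXv : ∀ i, ∃ r, R.X (gen q h (.v i)) = poly q h r * gen q h (.v i))
    (hXt : ∃ r, R.X (gen q h .t) = poly q h r)
    (d : Fin p → ℤ) (y : QGWA q h) (hy : y ∈ component q h d) :
    R.G y ∈ component q h d ∧ R.X y ∈ component q h d := by
  induction hy using Submodule.span_induction with
  | mem y hy =>
    obtain ⟨w, rfl, rfl⟩ := hy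
    induction w with
    | nil => simp [R.X_one, one_mem_component]
    | cons x w ih =>
      rw [List.map_cons, List.map_cons, List.prod_cons, List.sum_cons, map_mul, R.X_mul]
      have hw : (w.map (gen q h)).prod ∈ component q h (w.map QGWAGen.deg).sum :=
        Submodule.subset_span ⟨w, rfl, rfl⟩
      obtain ⟨b, hb⟩ := hG x
      rw [hb, smul_mul_assoc, smul_mul_assoc]
      refine ⟨Submodule.smul_mem _ _ (gen_mul_mem_component x ih.1),
        add_mem (Submodule.smul_mem _ _ (gen_mul_mem_component x ih.2)) ?_⟩
      cases x with
      | t =>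
        obtain ⟨r, hr⟩ := hXt
        rw [hr]
        simpa [QGWAGen.deg] using poly_mul_mem_component r hw
      | u i =>
        obtain ⟨r, hr⟩ := hXu i
        rw [hr, mul_assoc]
        exact poly_mul_mem_component r (gen_mul_mem_component _ hw)
      | v i =>
        obtain ⟨r, hr⟩ := hXv i
        rw [hr, mul_assoc]
        exact poly_mul_mem_component r (gen_mul_mem_component _ hw)
  | zero => simp
  | add y z _ _ hy hz =>
    rw [map_add, map_add]
    exact ⟨add_mem hy.1 hz.1, add_mem hy.2 hz.2⟩
  | smul c y _ hy =>
    rw [map_smul, map_smul]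
    exact ⟨Submodule.smul_mem _ _ hy.1, Submodule.smul_mem _ _ hy.2⟩

end QGWA

/-! ### The main theorem. -/

theorem corollary3p8 {k : Type*} [Field k] [CharZero k] {p : ℕ} (hp : 0 < p)
    -- the rank `p` quantum GWA `A`
    (q : Fin p → k) (h : Fin p → k[X])
    (hq0 : ∀ i, q i ≠ 0) (hq1 : ∀ i, q i ≠ 1)
    (hh : ∀ i, 0 < (h i).natDegree)
    -- `σ_i(h_j) = h_j` for `i ≠ j`: the compatibility condition for generalized Weyl algebras
    -- of higher rank
    (hσ : ∀ i j, i ≠ j → (h j).comp (Polynomial.C (q i) * Polynomial.X) = h j)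
    (hqneg : ∀ i, q i ≠ -1)
    -- the generalized Taft algebra `T = T_n(λ, m)`
    (D : TaftDatum k)
    -- the given actions on the subalgebras `A_i`
    (ρ : ∀ i, ModuleAlgebraStr k (TaftAlgebra D) (QGWA.rankOne q h i))
    (hρf : ∀ i, (ρ i).InnerFaithful)
    (hρg : ∀ i, (ρ i).WeaklyGraded (QGWA.rankOneComponent q h i))
    -- they agree on the common subalgebra `k[t]` of the `A_i`
    (hρt : ∀ i j (a : TaftAlgebra D) (f : k[X]),
      ((ρ i).act a (Polynomial.aeval (QGWA.rankOneT q h i) f) : QGWA q h) =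
        ((ρ j).act a (Polynomial.aeval (QGWA.rankOneT q h j) f) : QGWA q h)) :
    ∃ ρA : ModuleAlgebraStr k (TaftAlgebra D) (QGWA q h),
      ρA.InnerFaithful ∧ ρA.Graded (QGWA.component q h) ∧
      ∀ i (a : TaftAlgebra D) (y : QGWA.rankOne q h i),
        ρA.act a (y : QGWA q h) = ((ρ i).act a y : QGWA q h) := by
  have H : QGWA.Admissible q h := ⟨hq0, fun i h0 => by simpa [h0] using hh i, hσ⟩
  choose a τ hGt hXt hu hv using
    fun i => QGWA.exists_weights H (hq1 i) (hqneg i) (ρ i) (hρg i)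
  choose b r hbr hGu hXu using hu
  choose c s hcs hGv hXv using hv
  let i₀ : Fin p := ⟨0, hp⟩
  -- Agreement on `k[t]` is needed only for `g` and `x` acting on `t`: it makes the eigenvalue `a`
  -- and the polynomial `τ` independent of the index.
  have ha : ∀ i, a i = a i₀ := by
    intro i
    have h1 := hρt i i₀ (TaftAlgebra.g D) Polynomial.X
    rw [Polynomial.aeval_X, Polynomial.aeval_X] at h1
    have h2 := (hGt i).symm.trans (h1.trans (hGt i₀))
    rw [← QGWA.poly_X, ← map_smul, ← map_smul] at h2
    simpa using congrArg (fun f => Polynomial.coeff f 1) (QGWA.poly_injective H h2)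
  have hτ : ∀ i, τ i = τ i₀ := by
    intro i
    have h1 := hρt i i₀ (TaftAlgebra.x D) Polynomial.X
    rw [Polynomial.aeval_X, Polynomial.aeval_X] at h1
    exact QGWA.poly_injective H ((hXt i).symm.trans (h1.trans (hXt i₀)))
  obtain ⟨R, hR, hres⟩ := QGWA.exists_glue hp (fun i => (ρ i).toSkewDer)
    (fun i => (ρ i).toSkewDer_isTaft) (a i₀) (τ i₀) b c r s
    (fun i => by rw [hGt, ha]) (fun i => by rw [hXt, hτ])
    (fun i => ha i ▸ hτ i ▸ hbr i) hGu hXu (fun i => ha i ▸ hτ i ▸ hcs i) hGv hXv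
  have hact : ∀ i (e : TaftAlgebra D) (y : QGWA.rankOne q h i),
      SkewDer.act hR e y = ((ρ i).act e y : QGWA q h) := by
    intro i e
    induction e using TaftAlgebra.induction with
    | hc c => intro y; simp
    | hg => intro y; rw [SkewDer.act_g]; exact (hres i y).1
    | hx => intro y; rw [SkewDer.act_x]; exact (hres i y).2
    | hmul e f he hf =>
      intro y
      rw [map_mul, map_mul, Module.End.mul_apply, Module.End.mul_apply, hf, he]
    | hadd e f he hf =>
      intro y
      rw [map_add, map_add, LinearMap.add_apply, LinearMap.add_apply, he, hf, Subalgebra.coe_add]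
  have hstable := QGWA.stable_component R
    (by
      rintro (_ | i | i)
      · exact ⟨a i₀, (hres i₀ (QGWA.rankOneT q h i₀)).1.trans (hGt i₀)⟩
      · exact ⟨b i, (hres i (QGWA.rankOneU q h i)).1.trans (hGu i)⟩
      · exact ⟨c i, (hres i (QGWA.rankOneV q h i)).1.trans (hGv i)⟩)
    (fun i => ⟨r i, (hres i (QGWA.rankOneU q h i)).2.trans (hXu i)⟩)
    (fun i => ⟨s i, (hres i (QGWA.rankOneV q h i)).2.trans (hXv i)⟩)
    ⟨τ i₀, (hres i₀ (QGWA.rankOneT q h i₀)).2.trans (hXt i₀)⟩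
  refine ⟨SkewDer.toModuleAlgebraStr hR, ?_, ?_, hact⟩
  -- A Hopf ideal acting nontrivially on `A_{i₀}` acts nontrivially on `A`, because the new action
  -- restricts to the given one.
  · intro I h1 h2 h3
    obtain ⟨e, he, y, hy⟩ := hρf i₀ I h1 h2 h3
    refine ⟨e, he, y, fun h0 => hy (Subtype.ext ?_)⟩
    rw [← hact, ZeroMemClass.coe_zero]
    exact h0
  · intro d e
    change ∀ y ∈ _, SkewDer.act hR e y ∈ _
    induction e using TaftAlgebra.induction with
    | hc c =>
      intro y hy
      rw [AlgHom.commutes, Module.algebraMap_end_apply]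
      exact Submodule.smul_mem _ _ hy
    | hg => intro y hy; rw [SkewDer.act_g]; exact (hstable d y hy).1
    | hx => intro y hy; rw [SkewDer.act_x]; exact (hstable d y hy).2
    | hmul e f he hf =>
      intro y hy
      rw [map_mul, Module.End.mul_apply]
      exact he _ (hf y hy)
    | hadd e f he hf =>
      intro y hy
      rw [map_add, LinearMap.add_apply]
      exact add_mem (he y hy) (hf y hy)
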